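/- Let $\mathbb D$ be the unit disc. For a domain $G\subset\mathbb C^n$, a set $A\subset G$ and $z\in G$, define the generalized Green function $$g_G(A,z):=\sup\{u(z)\;:\;u:G\to[0,1),\ \log u\in\mathcal{PSH}(G),\ \forall a\in A\ \exists C=C(u,a)>0\ \forall w\in G:\ u(w)\le C\|w-a\|\}$$ (with $\log 0=-\infty$, the constant $-\infty$ being allowed as a plurisubharmonic function) and the generalized Möbius function $$m_G(A,z):=\sup\{|f(z)|\;:\;f:G\to\mathbb D \text{ holomorphic},\ f|_A\equiv 0\}.$$ Let $n\ge 2$, $p_1,\dots,p_n>0$, $1\le k\le n$, and put $$\mathbb E:=\Big\{z\in\mathbb C^n:\sum_{j=1}^n|z_j|^{2p_j}<1\Big\},\qquad A:=\{z\in\mathbb E: z_1\cdots z_k=0\}.$$ Define a function $R_{\mathbb E}(A,\cdot)$ on $\mathbb E$ as follows. If $z\in\mathbb E$ is such that the sequence $(p_j|z_j|^{2p_j})_{j=1}^k$ is (weakly) increasing, put, for $s\in\{1,\dots,k\}$, $$q_s:=\sum_{j=1}^s\frac1{2p_j},\qquad r_s(z):=1-\sum_{j=s+1}^n|z_j|^{2p_j},\qquad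 c_s(z):=\frac{r_s(z)}{q_s},$$ $$d:=\max\{s\in\{1,\dots,k\}:2p_s|z_s|^{2p_s}\le c_s(z)\},\qquad R_{\mathbb E}(A,z):=\prod_{j=1}^d|z_j|\Big(\frac{2p_j}{c_d(z)}\Big)^{\frac1{2p_j}}.$$ For an arbitrary $z\in\mathbb E$, apply a permutation of the first $k$ coordinates of $z$, and the same permutation to the exponents $p_1,\dots,p_k$, that makes this sequence increasing, and let $R_{\mathbb E}(A,z)$ be the value of the formula for the permuted point and exponents. (The statements below hold for every choice of such a permutation.) Then: (a) $g_{\mathbb E}(A,\cdot)\equiv R_{\mathbb E}(A,\cdot)$ on $\mathbb E$. (b) If $p_j\ge\frac12$ for $j=1,\dots,n$, then $m_{\mathbb E}(A,\cdot)\equiv g_{\mathbb E}(A,\cdot)\equiv R_{\mathbb E}(A,\cdot)$ on $\mathbb E$. (c) If $k=1$, $n=2$ and $p_2\ge\frac12$, then $m_{\mathbb E}(A,\cdot)\equiv g_{\mathbb E}(A,\cdot)\equiv R_{\mathbb E}(A,\cdot)$ on $\mathbb E$. (d) If there is a $j\in\{k+1,\dots,n\}$ with $p_j<\frac12$, then $m_{\mathbb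 E}(A,\cdot)\not\equiv g_{\mathbb E}(A,\cdot)$, that is, $m_{\mathbb E}(A,z)\ne g_{\mathbb E}(A,z)$ for some $z\in\mathbb E$. (e) If $k=n=2$, $p_1\le p_2$, and either $p_2\ge\frac12$ or $8p_1+4p_2(1-p_2)>1$, then $m_{\mathbb E}(A,\cdot)\equiv g_{\mathbb E}(A,\cdot)\equiv R_{\mathbb E}(A,\cdot)$ on $\mathbb E$. -/

import Mathlib

open MeasureTheory

noncomputable section

namespace MobiusGreen

/-! ### Plurisubharmonic functions -/

/-- The mean value over `(0, 2π)` of an extended real function, as the mean of the positive part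
minus the mean of the negative part. (For a function that is bounded above the first mean is
finite, so the difference is the usual one and takes values in `[-∞, ∞)`.) -/
def meanEReal (φ : ℝ → EReal) : EReal :=
  (((∫⁻ θ in Set.Ioc 0 (2 * Real.pi), (φ θ).toENNReal) / ENNReal.ofReal (2 * Real.pi) :
    ENNReal) : EReal)
    - (((∫⁻ θ in Set.Ioc 0 (2 * Real.pi), (-φ θ).toENNReal) / ENNReal.ofReal (2 * Real.pi) :
    ENNReal) : EReal)

/-- `φ : G → [-∞, ∞)` is plurisubharmonic on the open set `G`: it is upper semicontinuous, and it
satisfies the sub-mean value inequality on every closed complex disc that is contained in `G`.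
(The constant `-∞` is allowed.) -/
structure IsPSH {V : Type*} [NormedAddCommGroup V] [NormedSpace ℂ V]
    (G : Set V) (φ : V → EReal) : Prop where
  lt_top : ∀ z ∈ G, φ z < ⊤
  usc : UpperSemicontinuousOn φ G
  sub_mean : ∀ a b : V, (∀ t : ℂ, ‖t‖ ≤ 1 → a + t • b ∈ G) →
    φ a ≤ meanEReal fun θ => φ (a + Complex.exp (θ * Complex.I) • b)

/-! ### The generalized Green and Möbius functions -/

/-- The competitors for the generalized Green function: `u : G → [0, 1)` with `log u`
plurisubharmonic (`log 0 = -∞`) and, for each `a ∈ A`, `u w ≤ C ‖w - a‖` on `G` for some `C > 0`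
depending on `u` and `a`. -/
structure IsGreenCompetitor {V : Type*} [NormedAddCommGroup V] [NormedSpace ℂ V]
    (G A : Set V) (u : V → ℝ) : Prop where
  mem_Ico : ∀ w ∈ G, u w ∈ Set.Ico (0 : ℝ) 1
  log_psh : IsPSH G fun w => ENNReal.log (ENNReal.ofReal (u w))
  pole : ∀ a ∈ A, ∃ C : ℝ, 0 < C ∧ ∀ w ∈ G, u w ≤ C * ‖w - a‖

/-- The generalized Green function `g_G(A, z)`, for `z ∈ G`. -/
def green {V : Type*} [NormedAddCommGroup V] [NormedSpace ℂ V] (G A : Set V) (z : V) : ℝ :=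
  sSup {x : ℝ | ∃ u : V → ℝ, IsGreenCompetitor G A u ∧ x = u z}

/-- The competitors for the generalized Möbius function: holomorphic `f : G → 𝔻` that vanish on
`A`. -/
structure IsMobiusCompetitor {V : Type*} [NormedAddCommGroup V] [NormedSpace ℂ V]
    (G A : Set V) (f : V → ℂ) : Prop where
  holo : DifferentiableOn ℂ f G
  mapsTo : ∀ w ∈ G, ‖f w‖ < 1
  zero : ∀ a ∈ A, f a = 0

/-- The generalized Möbius function `m_G(A, z)`, for `z ∈ G`. -/
def mobius {V : Type*} [NormedAddCommGroup V] [NormedSpace ℂ V] (G A : Set V) (z : V) : ℝ :=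
  sSup {x : ℝ | ∃ f : V → ℂ, IsMobiusCompetitor G A f ∧ x = ‖f z‖}

/-! ### Complex ellipsoids

Coordinates are indexed by `Fin n`, so that the `s`-th coordinate of the usual numbering
`1, …, n` has index `s - 1`; the first `s` coordinates are those with index `< s`. -/

/-- The complex ellipsoid with exponents `p`. -/
def ellipsoid {n : ℕ} (p : Fin n → ℝ) : Set (EuclideanSpace ℂ (Fin n)) :=
  {z | ∑ j, ‖z j‖ ^ (2 * p j) < 1}

/-- The points of `G` at which the product of the first `k` coordinates vanishes. -/
def hyperplanes {n : ℕ} (G : Set (EuclideanSpace ℂ (Fin n))) (k : ℕ) :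
    Set (EuclideanSpace ℂ (Fin n)) :=
  {z | z ∈ G ∧ ∏ j ∈ Finset.univ.filter (fun j : Fin n => (j : ℕ) < k), z j = 0}

/-! ### The explicit function -/

/-- `q_s = ∑_{j ≤ s} (2 p_j)⁻¹`. -/
def qSum {n : ℕ} (p : Fin n → ℝ) (s : ℕ) : ℝ :=
  ∑ j ∈ Finset.univ.filter (fun j : Fin n => (j : ℕ) < s), (2 * p j)⁻¹

/-- `r_s(z) = 1 - ∑_{j > s} |z_j| ^ (2 p_j)`. -/
def rRem {n : ℕ} (p : Fin n → ℝ) (s : ℕ) (z : Fin n → ℂ) : ℝ :=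
  1 - ∑ j ∈ Finset.univ.filter (fun j : Fin n => s ≤ (j : ℕ)), ‖z j‖ ^ (2 * p j)

/-- `c_s(z) = r_s(z) / q_s`. -/
def cQuot {n : ℕ} (p : Fin n → ℝ) (s : ℕ) (z : Fin n → ℂ) : ℝ :=
  rRem p s z / qSum p s

/-- `d = max {s ∈ {1, …, k} : 2 p_s |z_s| ^ (2 p_s) ≤ c_s(z)}`; here `i` is the index of the
`s`-th coordinate. -/
def dMax {n : ℕ} (p : Fin n → ℝ) (k : ℕ) (z : Fin n → ℂ) : ℕ :=
  sSup {s : ℕ | s ≤ k ∧ ∃ i : Fin n, s = (i : ℕ) + 1 ∧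
    2 * p i * ‖z i‖ ^ (2 * p i) ≤ cQuot p s z}

/-- The explicit formula `∏_{j ≤ d} |z_j| (2 p_j / c_d(z)) ^ (1 / (2 p_j))`, which is meant for
points `z` of the ellipsoid with `p_j |z_j| ^ (2 p_j)` increasing for `j ≤ k`. -/
def formulaR {n : ℕ} (p : Fin n → ℝ) (k : ℕ) (z : Fin n → ℂ) : ℝ :=
  ∏ j ∈ Finset.univ.filter (fun j : Fin n => (j : ℕ) < dMax p k z),
    ‖z j‖ * (2 * p j / cQuot p (dMax p k z) z) ^ (1 / (2 * p j))

/-- `σ` permutes the first `k` coordinates only, and makes the sequence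
`(p_j |z_j| ^ (2 p_j))_{j ≤ k}` increasing. -/
def IsSorting {n : ℕ} (p : Fin n → ℝ) (k : ℕ) (z : Fin n → ℂ) (σ : Equiv.Perm (Fin n)) : Prop :=
  (∀ j : Fin n, k ≤ (j : ℕ) → σ j = j) ∧
    ∀ i j : Fin n, i ≤ j → (j : ℕ) < k →
      p (σ i) * ‖z (σ i)‖ ^ (2 * p (σ i)) ≤ p (σ j) * ‖z (σ j)‖ ^ (2 * p (σ j))

/-- Every point has a sorting permutation. -/
theorem exists_isSorting {n : ℕ} (p : Fin n → ℝ) {k : ℕ} (hk : k ≤ n) (z : Fin n → ℂ) :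
    ∃ σ, IsSorting p k z σ := by
  let v : Fin n → ℝ := fun j => p j * ‖z j‖ ^ (2 * p j)
  let w : Fin k → ℝ := fun j => v (Fin.castLE hk j)
  let e : Fin k ↪ Fin n := Fin.castLEEmb hk
  refine ⟨(Tuple.sort w).viaFintypeEmbedding e, fun j hj => ?_, fun i j hij hj => ?_⟩
  · apply Equiv.Perm.viaFintypeEmbedding_apply_notMem_range
    rintro ⟨x, hx⟩
    have h1 : (j : ℕ) = x := by rw [← hx]; rfl
    omega
  · have hi : (i : ℕ) < k := lt_of_le_of_lt hij hj
    have h1 : i = e ⟨i, hi⟩ := rfl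
    have h2 : j = e ⟨j, hj⟩ := rfl
    rw [h1, h2, Equiv.Perm.viaFintypeEmbedding_apply_image,
      Equiv.Perm.viaFintypeEmbedding_apply_image]
    exact Tuple.monotone_sort w (show (⟨i, hi⟩ : Fin k) ≤ ⟨j, hj⟩ from hij)

/-- `F ≡ R` on the ellipsoid: at each point `z`, for each way to bring the first `k` coordinates
of `z` (together with their exponents) into increasing order, `F z` is the value of the explicit
formula at the permuted point. -/
def EqualsR {n : ℕ} (p : Fin n → ℝ) (k : ℕ) (F : EuclideanSpace ℂ (Fin n) → ℝ) : Prop :=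
  ∀ z ∈ ellipsoid p, ∀ σ : Equiv.Perm (Fin n), IsSorting p k z σ →
    F z = formulaR (fun j => p (σ j)) k (fun j => z (σ j))

end MobiusGreen

end

noncomputable section

namespace MobiusGreen

/-! ### Circle means of extended real functions -/

/-! Everything rests on a number `c > 0` for which the levels `X j` of `z` (`level`) sum to `1`.
With `ξ j ^ (2 p j) = X j`, the extremal value is `∏ |z j| / ξ j` over `j < k` (`levelProd`). For
sorted `z`, `c_d(z)` is such a `c`, and the explicit formula is this product
(`formulaR_eq_levelProd_of_sorted`).

Upper bound (`IsSchwarzOn.le_levelProd`): freeze the coordinates with `X j = |z j| ^ (2 p j)`. The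
others may range over the polydisc with radii `ξ j`, which stays in the ellipsoid, and setting one
of them to `0` gives a point of `A`. The one-variable Schwarz lemma in each of them bounds `u` and
`|f|` alike.

Lower bound for the Green function: by the weighted AM-GM inequality with weights `X j`, the product
of the `(|w j| ^ (2 p j) / X j) ^ (X j / c)` is a competitor that attains the bound at `z`.

Lower bound for the Möbius function: this competitor has to be replaced by a holomorphic one. Where
`|w j| ^ (2 p j)` is convex, its supporting hyperplanes yield a monomial times a power of an affine
function (`exists_isMobiusCompetitor_of_convex`). For `k = n = 2` without convexity, `w i * w j`
times an exponential works, thanks to the concavity of `log t + b log (1 - t ^ (2 p))`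
(`exists_isMobiusCompetitor_of_exp`).

For (d), move a free coordinate `t` away from `0`: the Green function grows at least like `|t| ^ (2
p)` with `2 p < 1`, whereas Schwarz's lemma allows only linear growth of `|f|`. -/

lemma meanEReal_mono {φ ψ : ℝ → EReal} (h : ∀ θ, φ θ ≤ ψ θ) : meanEReal φ ≤ meanEReal ψ := by
  unfold meanEReal
  refine EReal.sub_le_sub ?_ ?_
  · rw [EReal.coe_ennreal_le_coe_ennreal_iff]
    gcongr with θ
    exact EReal.toENNReal_le_toENNReal (h θ)
  · rw [EReal.coe_ennreal_le_coe_ennreal_iff]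
    gcongr with θ
    exact EReal.toENNReal_le_toENNReal (EReal.neg_le_neg_iff.2 (h θ))

/-- Equality almost everywhere is enough, so the points at which `φ` is `-∞` can be discarded. -/
lemma meanEReal_eq_circleAverage {g : ℂ → ℝ} {φ : ℝ → EReal} (hg : CircleIntegrable g 0 1)
    (h : ∀ᵐ θ ∂(volume.restrict (Set.Ioc 0 (2 * Real.pi))), φ θ = (g (circleMap 0 1 θ) : ℝ)) :
    meanEReal φ = (Real.circleAverage g 0 1 : ℝ) := by
  have hpi : (0 : ℝ) < 2 * Real.pi := Real.two_pi_pos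
  have hint : Integrable (fun θ => g (circleMap 0 1 θ))
      (volume.restrict (Set.Ioc 0 (2 * Real.pi))) := by
    have := hg
    rw [CircleIntegrable, intervalIntegrable_iff_integrableOn_Ioc_of_le hpi.le] at this
    exact this
  have h1 : ∫⁻ θ in Set.Ioc 0 (2 * Real.pi), (φ θ).toENNReal
      = ∫⁻ θ in Set.Ioc 0 (2 * Real.pi), ENNReal.ofReal (g (circleMap 0 1 θ)) := by
    refine lintegral_congr_ae ?_
    filter_upwards [h] with θ hθ
    rw [hθ, EReal.toENNReal_of_ne_top (EReal.coe_ne_top _), EReal.toReal_coe]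
  have h2 : ∫⁻ θ in Set.Ioc 0 (2 * Real.pi), (-φ θ).toENNReal
      = ∫⁻ θ in Set.Ioc 0 (2 * Real.pi), ENNReal.ofReal (-g (circleMap 0 1 θ)) := by
    refine lintegral_congr_ae ?_
    filter_upwards [h] with θ hθ
    rw [hθ, ← EReal.coe_neg, EReal.toENNReal_of_ne_top (EReal.coe_ne_top _), EReal.toReal_coe]
  have f1 := hint.lintegral_lt_top
  have f2 := hint.neg.lintegral_lt_top
  simp only [Pi.neg_apply] at f2
  have key : ∀ x : ENNReal, x < ⊤ →
      ((x / ENNReal.ofReal (2 * Real.pi) : ENNReal) : EReal)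
        = ((x.toReal / (2 * Real.pi) : ℝ) : EReal) := by
    intro x hx
    have hfin : x / ENNReal.ofReal (2 * Real.pi) ≠ ⊤ :=
      ENNReal.div_ne_top hx.ne (by simpa using hpi)
    rw [← EReal.coe_ennreal_toReal hfin, ENNReal.toReal_div, ENNReal.toReal_ofReal hpi.le]
  unfold meanEReal
  rw [h1, h2, key _ f1, key _ f2, ← EReal.coe_sub, Real.circleAverage_def,
    intervalIntegral.integral_of_le hpi.le,
    integral_eq_lintegral_pos_part_sub_lintegral_neg_part hint, smul_eq_mul]
  congr 1
  field_simp

lemma circleMap_zero_one (θ : ℝ) : circleMap 0 1 θ = Complex.exp (θ * Complex.I) := by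
  simp [circleMap]

/-- A plurisubharmonic function which on a circle is dominated by a real integrable function is
at the centre at most the average of that function. -/
lemma IsPSH.le_circleAverage {V : Type*} [NormedAddCommGroup V] [NormedSpace ℂ V]
    {G : Set V} {φ : V → EReal} (hφ : IsPSH G φ) {a b : V}
    (hG : ∀ t : ℂ, ‖t‖ ≤ 1 → a + t • b ∈ G) {g : ℂ → ℝ} (hg : CircleIntegrable g 0 1)
    (h : ∀ t : ℂ, ‖t‖ = 1 → φ (a + t • b) ≤ (g t : ℝ)) :
    φ a ≤ (Real.circleAverage g 0 1 : ℝ) := by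
  refine (hφ.sub_mean a b hG).trans ?_
  rw [← meanEReal_eq_circleAverage (φ := fun θ => (g (circleMap 0 1 θ) : ℝ)) hg
    (Filter.Eventually.of_forall fun _ => rfl)]
  refine meanEReal_mono fun θ => ?_
  rw [circleMap_zero_one]
  exact h _ (Complex.norm_exp_ofReal_mul_I θ)

/-! ### The Schwarz lemma for logarithmically plurisubharmonic functions -/

/-- The average over the circle `‖t - t₁‖ = r` of `-s log ‖t‖ + δ ‖t‖²`, where the closed disc
does not contain the origin. -/
lemma circleAverage_neg_log_add_sq {t₁ : ℂ} {r s δ : ℝ} (hr : 0 ≤ r) (hrt : r < ‖t₁‖) :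
    CircleIntegrable
      (fun ζ : ℂ => -s * Real.log ‖t₁ + r * ζ‖ + δ * ‖t₁ + r * ζ‖ ^ 2) 0 1 ∧
    Real.circleAverage
      (fun ζ : ℂ => -s * Real.log ‖t₁ + r * ζ‖ + δ * ‖t₁ + r * ζ‖ ^ 2) 0 1
      = -s * Real.log ‖t₁‖ + δ * (‖t₁‖ ^ 2 + r ^ 2) := by
  have hne : ∀ ζ : ℂ, ‖ζ‖ ≤ 1 → t₁ + r * ζ ≠ 0 := by
    intro ζ hζ h0
    have h1 : t₁ = -(r * ζ) := eq_neg_of_add_eq_zero_left h0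
    have h2 : ‖t₁‖ = r * ‖ζ‖ := by
      rw [h1, norm_neg, norm_mul, Complex.norm_real, Real.norm_of_nonneg hr]
    nlinarith [norm_nonneg ζ]
  -- On the unit circle `‖t₁ + r ζ‖ ^ 2 = ‖t₁‖ ^ 2 + r ^ 2 + 2 r Re (conj t₁ * ζ)`, so there the
  -- integrand agrees with a function harmonic on the whole disc, and the mean value property
  -- applies.
  set H : ℂ → ℝ := fun ζ => (-s) • Real.log ‖t₁ + r * ζ‖ +
    (δ * (‖t₁‖ ^ 2 + r ^ 2) + δ • (2 * r * (starRingEnd ℂ t₁) * ζ).re) with hH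
  have hharm : InnerProductSpace.HarmonicOnNhd H (Metric.closedBall 0 |1|) := by
    intro ζ hζ
    rw [abs_one, mem_closedBall_zero_iff] at hζ
    refine InnerProductSpace.HarmonicAt.add ?_ (InnerProductSpace.HarmonicAt.add ?_ ?_)
    · refine InnerProductSpace.HarmonicAt.const_smul ?_
      exact AnalyticAt.harmonicAt_log_norm (f := fun ζ => t₁ + r * ζ) (by fun_prop) (hne ζ hζ)
    · exact InnerProductSpace.harmonicAt_const _
    · refine InnerProductSpace.HarmonicAt.const_smul ?_
      exact AnalyticAt.harmonicAt_re (f := fun ζ => 2 * r * (starRingEnd ℂ t₁) * ζ) (by fun_prop)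
  have heq : Set.EqOn (fun ζ : ℂ => -s * Real.log ‖t₁ + r * ζ‖ + δ * ‖t₁ + r * ζ‖ ^ 2) H
      (Metric.sphere 0 |1|) := by
    intro ζ hζ
    rw [abs_one, mem_sphere_zero_iff_norm] at hζ
    have h1 : ‖t₁ + r * ζ‖ ^ 2 = ‖t₁‖ ^ 2 + r ^ 2 + (2 * r * (starRingEnd ℂ t₁) * ζ).re := by
      have h2 : ‖ζ‖ ^ 2 = 1 := by rw [hζ]; norm_num
      rw [← Complex.normSq_eq_norm_sq, Complex.normSq_apply] at h2 ⊢
      rw [← Complex.normSq_eq_norm_sq, Complex.normSq_apply]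
      simp
      linear_combination r ^ 2 * h2
    simp only [hH, h1, smul_eq_mul]
    ring
  constructor
  · refine ContinuousOn.circleIntegrable' ?_
    refine ContinuousOn.congr ?_ heq
    exact hharm.continuousOn.mono Metric.sphere_subset_closedBall
  · rw [Real.circleAverage_congr_sphere heq, hharm.circleAverage_eq]
    simp [hH]

/-- The maximum principle on an annulus for `φ - s log ‖t‖ + δ ‖t‖²`, where `φ` is
plurisubharmonic. -/
lemma IsPSH.le_of_le_on_boundary_annulus {V : Type*} [NormedAddCommGroup V] [NormedSpace ℂ V]
    {G : Set V} {φ : V → EReal} (hφ : IsPSH G φ) {a b : V} {η ρ s δ B : ℝ} (hη : 0 < η)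
    (hδ : 0 < δ) (hG : ∀ t : ℂ, η ≤ ‖t‖ → ‖t‖ ≤ ρ → a + t • b ∈ G)
    (hb : ∀ t : ℂ, ‖t‖ = η ∨ ‖t‖ = ρ → η ≤ ‖t‖ → ‖t‖ ≤ ρ →
      φ (a + t • b) ≤ ((B + s * Real.log ‖t‖ - δ * ‖t‖ ^ 2 : ℝ) : EReal))
    {t₀ : ℂ} (h₁ : η ≤ ‖t₀‖) (h₂ : ‖t₀‖ ≤ ρ) :
    φ (a + t₀ • b) ≤ ((B + s * Real.log ‖t₀‖ - δ * ‖t₀‖ ^ 2 : ℝ) : EReal) := by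
  set S : Set ℂ := {t | η ≤ ‖t‖ ∧ ‖t‖ ≤ ρ} with hS
  set h : ℂ → ℝ := fun t => -s * Real.log ‖t‖ + δ * ‖t‖ ^ 2 with hh
  have hSc : IsCompact S := by
    refine (isCompact_closedBall (0 : ℂ) ρ).of_isClosed_subset ?_ ?_
    · exact (isClosed_le continuous_const continuous_norm).inter
        (isClosed_le continuous_norm continuous_const)
    · rintro t ⟨-, ht⟩
      simpa using ht
  have hcont : ContinuousOn h S := by
    refine ContinuousOn.add (ContinuousOn.mul continuousOn_const ?_) (by fun_prop)
    refine ContinuousOn.log (by fun_prop) ?_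
    rintro t ⟨ht, -⟩
    exact (hη.trans_le ht).ne'
  have husc : UpperSemicontinuousOn (fun t => φ (a + t • b) + ((h t : ℝ) : EReal)) S := by
    refine UpperSemicontinuousOn.add' (f := fun t => φ (a + t • b)) ?_ ?_ ?_
    · intro t ht
      have h3 := hφ.usc (a + t • b) (hG t ht.1 ht.2)
      have h4 : ContinuousWithinAt (fun t : ℂ => a + t • b) S t := by fun_prop
      intro y hy
      have h5 := h3 y hy
      have h6 : Filter.Tendsto (fun t : ℂ => a + t • b) (nhdsWithin t S)
          (nhdsWithin (a + t • b) G) :=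
        tendsto_nhdsWithin_iff.2 ⟨h4, eventually_nhdsWithin_of_forall fun t ht => hG t ht.1 ht.2⟩
      exact h6.eventually h5
    · exact (continuous_coe_real_ereal.comp_continuousOn hcont).upperSemicontinuousOn
    · intro t _
      exact EReal.continuousAt_add (Or.inr (EReal.coe_ne_bot _)) (Or.inr (EReal.coe_ne_top _))
  obtain ⟨t₁, ht₁, hmax⟩ := husc.exists_isMaxOn (s := S) ⟨t₀, h₁, h₂⟩ hSc
  have hB : φ (a + t₁ • b) + ((h t₁ : ℝ) : EReal) ≤ (B : ℝ) := by
    by_cases hbd : ‖t₁‖ = η ∨ ‖t₁‖ = ρ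
    · calc φ (a + t₁ • b) + ((h t₁ : ℝ) : EReal)
          ≤ ((B + s * Real.log ‖t₁‖ - δ * ‖t₁‖ ^ 2 : ℝ) : EReal) + ((h t₁ : ℝ) : EReal) := by
            gcongr
            exact hb t₁ hbd ht₁.1 ht₁.2
        _ = (B : ℝ) := by
            rw [← EReal.coe_add]
            congr 1
            simp only [hh]
            ring
    push Not at hbd
    have hl : η < ‖t₁‖ := lt_of_le_of_ne ht₁.1 (Ne.symm hbd.1)
    have hu : ‖t₁‖ < ρ := lt_of_le_of_ne ht₁.2 hbd.2
    -- At an interior maximum, the sub-mean value inequality on a small disc of radius `r` is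
    -- violated by `δ r ^ 2`, the contribution of the strictly subharmonic term.
    obtain ⟨r, hr0, hr⟩ : ∃ r : ℝ, 0 < r ∧ r < min (‖t₁‖ - η) (ρ - ‖t₁‖) :=
      exists_between (lt_min (by linarith) (by linarith))
    have hr1 := hr.trans_le (min_le_left _ _)
    have hr2 := hr.trans_le (min_le_right _ _)
    have hmem : ∀ ζ : ℂ, ‖ζ‖ ≤ 1 → t₁ + r * ζ ∈ S := by
      intro ζ hζ
      have h3 : ‖(r : ℂ) * ζ‖ ≤ r := by
        rw [norm_mul, Complex.norm_real, Real.norm_of_nonneg hr0.le]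
        nlinarith
      constructor
      · have := norm_sub_norm_le t₁ (-(r * ζ))
        rw [norm_neg, sub_neg_eq_add] at this
        linarith
      · have := norm_add_le t₁ (r * ζ)
        linarith
    have hline : ∀ ζ : ℂ, (a + t₁ • b) + ζ • ((r : ℂ) • b) = a + (t₁ + r * ζ) • b := by
      intro ζ
      module
    obtain hbot | ⟨l, hl1⟩ : φ (a + t₁ • b) = ⊥ ∨ ∃ l : ℝ, φ (a + t₁ • b) = (l : ℝ) := by
      have htop := hφ.lt_top (a + t₁ • b) (hG t₁ ht₁.1 ht₁.2)
      induction h : φ (a + t₁ • b) with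
      | bot => exact Or.inl rfl
      | top => exact absurd h htop.ne
      | coe l => exact Or.inr ⟨l, rfl⟩
    · rw [hbot]
      simp
    exfalso
    obtain ⟨hci, hca⟩ := circleAverage_neg_log_add_sq (t₁ := t₁) (s := s) (δ := δ) hr0.le
      (by linarith)
    set g : ℂ → ℝ := fun ζ => -s * Real.log ‖t₁ + r * ζ‖ + δ * ‖t₁ + r * ζ‖ ^ 2 with hg
    have hci' : CircleIntegrable (fun ζ => (l + h t₁) - g ζ) 0 1 :=
      CircleIntegrable.sub (circleIntegrable_const _ _ _) hci
    have h7 := hφ.le_circleAverage (a := a + t₁ • b) (b := (r : ℂ) • b)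
      (fun ζ hζ => by rw [hline]; exact hG _ (hmem ζ hζ).1 (hmem ζ hζ).2) hci' (by
        intro ζ hζ
        rw [hline]
        have h8 := hmax (hmem ζ hζ.le)
        simp only [Set.mem_ofPred_eq, hl1] at h8
        have h9 := hφ.lt_top (a + (t₁ + r * ζ) • b) (hG _ (hmem ζ hζ.le).1 (hmem ζ hζ.le).2)
        induction h10 : φ (a + (t₁ + r * ζ) • b) with
        | bot => exact bot_le
        | top => exact absurd h10 h9.ne
        | coe l' =>
          rw [h10, ← EReal.coe_add, ← EReal.coe_add, EReal.coe_le_coe_iff] at h8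
          rw [EReal.coe_le_coe_iff]
          have : h (t₁ + r * ζ) = g ζ := rfl
          linarith)
    have h11 : Real.circleAverage (fun ζ => (l + h t₁) - g ζ) 0 1
        = (l + h t₁) - Real.circleAverage g 0 1 := by
      have := Real.circleAverage_sub (circleIntegrable_const (l + h t₁) 0 1) hci
      rw [Real.circleAverage_const] at this
      exact this
    rw [hl1, h11, hca, EReal.coe_le_coe_iff] at h7
    have : 0 < δ * r ^ 2 := by positivity
    simp only [hh] at h7
    linarith
  have h3 := (hmax (⟨h₁, h₂⟩ : t₀ ∈ S)).trans hB
  have h4 := hφ.lt_top (a + t₀ • b) (hG t₀ h₁ h₂)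
  induction h5 : φ (a + t₀ • b) with
  | bot => exact bot_le
  | top => exact absurd h5 h4.ne
  | coe l =>
    simp only [h5] at h3
    rw [← EReal.coe_add, EReal.coe_le_coe_iff] at h3
    rw [EReal.coe_le_coe_iff]
    simp only [hh] at h3
    linarith

lemma log_ofReal_le_coe {x y : ℝ} (h : x ≤ Real.exp y) :
    ENNReal.log (ENNReal.ofReal x) ≤ (y : ℝ) := by
  rcases le_or_gt x 0 with hx | hx
  · rw [ENNReal.ofReal_eq_zero.2 hx, ENNReal.log_zero]
    exact bot_le
  · rw [ENNReal.log_ofReal_of_pos hx, EReal.coe_le_coe_iff]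
    exact (Real.log_le_iff_le_exp hx).2 h

/-- The Schwarz lemma for competitors of the Green function, on closed discs. -/
lemma IsGreenCompetitor.le_mul_div_of_closedBall {V : Type*} [NormedAddCommGroup V]
    [NormedSpace ℂ V] {G A : Set V} {u : V → ℝ} (hu : IsGreenCompetitor G A u) {a b : V}
    (ha : a ∈ A) {ρ M : ℝ} (hG : ∀ t : ℂ, ‖t‖ ≤ ρ → a + t • b ∈ G)
    (hM : ∀ t : ℂ, ‖t‖ ≤ ρ → u (a + t • b) ≤ M) {t₀ : ℂ} (ht₀ : ‖t₀‖ ≤ ρ) :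
    u (a + t₀ • b) ≤ M * (‖t₀‖ / ρ) := by
  obtain ⟨C, hC, hpole⟩ := hu.pole a ha
  have hM0 : 0 ≤ M := ((hu.mem_Ico _ (hG t₀ ht₀)).1).trans (hM t₀ ht₀)
  have hρ0 : 0 ≤ ρ := (norm_nonneg _).trans ht₀
  rcases le_or_gt (u (a + t₀ • b)) 0 with hneg | hpos
  · exact hneg.trans (by positivity)
  have hMpos : 0 < M := hpos.trans_le (hM t₀ ht₀)
  have hC' : ∀ t : ℂ, ‖t‖ ≤ ρ → u (a + t • b) ≤ C * ‖b‖ * ‖t‖ := by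
    intro t ht
    have := hpole _ (hG t ht)
    rw [add_sub_cancel_left, norm_smul] at this
    linarith
  have hCb : 0 < C * ‖b‖ * ‖t₀‖ := hpos.trans_le (hC' t₀ ht₀)
  have ht₀pos : 0 < ‖t₀‖ := by
    by_contra h
    have : ‖t₀‖ = 0 := le_antisymm (not_lt.1 h) (norm_nonneg _)
    rw [this, mul_zero] at hCb
    exact lt_irrefl _ hCb
  have hρ : 0 < ρ := ht₀pos.trans_le ht₀
  set D := C * ‖b‖ with hD
  have hDpos : 0 < D := pos_of_mul_pos_left hCb ht₀pos.le
  -- Compare with `(1 - ε) log ‖t‖` rather than `log ‖t‖`: the spare `ε log ‖t‖` tends to `-∞` at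
  -- the centre and absorbs the unknown pole constant `C` on a small inner circle. The constant `B`
  -- gives equality on the outer circle; then `ε → 0`.
  have key : ∀ ε : ℝ, 0 < ε → ε < 1 → Real.log (u (a + t₀ • b)) ≤
      Real.log M - Real.log ρ + Real.log ‖t₀‖ + ε * (Real.log ρ - Real.log ‖t₀‖ + ρ ^ 2) := by
    intro ε hε hε1
    set B := Real.log M - (1 - ε) * Real.log ρ + ε * ρ ^ 2 with hB
    obtain ⟨η, hη0, hη1, hη2⟩ : ∃ η : ℝ, 0 < η ∧ η ≤ ‖t₀‖ ∧
        Real.log D + ε * Real.log η + ε * ρ ^ 2 ≤ B := by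
      set y := (B - Real.log D - ε * ρ ^ 2) / ε with hy
      refine ⟨min ‖t₀‖ (Real.exp y), lt_min ht₀pos (Real.exp_pos _), min_le_left _ _, ?_⟩
      have h1 : Real.log (min ‖t₀‖ (Real.exp y)) ≤ y := by
        rw [← Real.log_exp y]
        refine Real.log_le_log (lt_min ht₀pos (Real.exp_pos _)) ?_
        rw [Real.log_exp]
        exact min_le_right _ _
      have h2 : ε * Real.log (min ‖t₀‖ (Real.exp y)) ≤ ε * y := by gcongr
      have h3 : ε * y = B - Real.log D - ε * ρ ^ 2 := by
        rw [hy]; field_simp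
      linarith
    have h4 := hu.log_psh.le_of_le_on_boundary_annulus (a := a) (b := b) (η := η) (ρ := ρ)
      (s := 1 - ε) (δ := ε) (B := B) hη0 hε (fun t _ ht => hG t ht) (by
        intro t ht ht1 ht2
        have htpos : 0 < ‖t‖ := hη0.trans_le ht1
        refine log_ofReal_le_coe ?_
        have hsq : ε * ‖t‖ ^ 2 ≤ ε * ρ ^ 2 := by gcongr
        rcases ht with ht | ht
        · refine (hC' t ht2).trans ?_
          rw [← Real.log_le_iff_le_exp (by positivity), Real.log_mul hDpos.ne' htpos.ne', ht]
          rw [ht] at hsq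
          linarith
        · refine (hM t ht2).trans ?_
          rw [← Real.log_le_iff_le_exp hMpos, ht]
          linarith) hη1 ht₀
    rw [ENNReal.log_ofReal_of_pos hpos, EReal.coe_le_coe_iff] at h4
    have : 0 ≤ ε * ‖t₀‖ ^ 2 := by positivity
    linarith
  have hlog : Real.log (u (a + t₀ • b)) ≤ Real.log M - Real.log ρ + Real.log ‖t₀‖ := by
    refine ge_of_tendsto (x := nhdsWithin (0 : ℝ) (Set.Ioi 0)) (f := fun ε : ℝ =>
      Real.log M - Real.log ρ + Real.log ‖t₀‖ + ε * (Real.log ρ - Real.log ‖t₀‖ + ρ ^ 2)) ?_ ?_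
    · have : Continuous fun ε : ℝ => Real.log M - Real.log ρ + Real.log ‖t₀‖ +
          ε * (Real.log ρ - Real.log ‖t₀‖ + ρ ^ 2) := by fun_prop
      have h := (this.tendsto 0).mono_left (nhdsWithin_le_nhds (s := Set.Ioi 0))
      simpa using h
    · filter_upwards [Ioo_mem_nhdsGT (zero_lt_one (α := ℝ))] with ε hε
      exact key ε hε.1 hε.2
  rw [← Real.log_div hMpos.ne' hρ.ne', ← Real.log_mul (by positivity) ht₀pos.ne'] at hlog
  have := (Real.log_le_log_iff hpos (by positivity)).1 hlog
  calc u (a + t₀ • b) ≤ M / ρ * ‖t₀‖ := this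
    _ = M * (‖t₀‖ / ρ) := by ring

/-- `u` satisfies the Schwarz lemma on the discs in `G` that are centred at points of `A`. -/
def IsSchwarzOn {V : Type*} [NormedAddCommGroup V] [NormedSpace ℂ V] (G A : Set V)
    (u : V → ℝ) : Prop :=
  ∀ a ∈ A, ∀ (b : V) (ρ M : ℝ), (∀ t : ℂ, ‖t‖ < ρ → a + t • b ∈ G) →
    (∀ t : ℂ, ‖t‖ < ρ → u (a + t • b) ≤ M) → ∀ t : ℂ, ‖t‖ < ρ → u (a + t • b) ≤ M * (‖t‖ / ρ)

lemma IsGreenCompetitor.isSchwarzOn {V : Type*} [NormedAddCommGroup V]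
    [NormedSpace ℂ V] {G A : Set V} {u : V → ℝ} (hu : IsGreenCompetitor G A u) :
    IsSchwarzOn G A u := by
  intro a ha b ρ M hG hM t ht
  have hρ : 0 < ρ := (norm_nonneg t).trans_lt ht
  refine ge_of_tendsto (x := nhdsWithin ρ (Set.Iio ρ)) (f := fun σ : ℝ => M * (‖t‖ / σ)) ?_ ?_
  · have : ContinuousAt (fun σ : ℝ => M * (‖t‖ / σ)) ρ := by
      fun_prop (disch := exact hρ.ne')
    exact this.tendsto.mono_left nhdsWithin_le_nhds
  · filter_upwards [Ioo_mem_nhdsLT ht] with σ hσ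
    exact hu.le_mul_div_of_closedBall ha (fun t ht => hG t (ht.trans_lt hσ.2))
      (fun t ht => hM t (ht.trans_lt hσ.2)) hσ.1.le

/-- The classical Schwarz lemma. Through it the upper bound covers the Möbius function without `log
‖f‖` having to be shown plurisubharmonic. -/
lemma IsMobiusCompetitor.isSchwarzOn {V : Type*} [NormedAddCommGroup V]
    [NormedSpace ℂ V] {G A : Set V} {f : V → ℂ} (hf : IsMobiusCompetitor G A f) :
    IsSchwarzOn G A fun w => ‖f w‖ := by
  intro a ha b ρ M hG hM t ht
  have h0 : f (a + (0 : ℂ) • b) = 0 := by simp [hf.zero a ha]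
  have hd : DifferentiableOn ℂ (fun t : ℂ => f (a + t • b)) (Metric.ball 0 ρ) :=
    hf.holo.comp (by fun_prop) fun t ht => hG t (by simpa using ht)
  have := Complex.dist_le_div_mul_dist_of_mapsTo_ball (R₂ := M) hd (fun t ht => by
    rw [h0, mem_closedBall_zero_iff]
    exact hM t (by simpa using ht)) (z := t) (by simpa using ht)
  rw [h0, dist_zero_right, dist_zero_right] at this
  calc ‖f (a + t • b)‖ ≤ M / ρ * ‖t‖ := this
    _ = M * (‖t‖ / ρ) := by ring

/-! ### Monomials with real exponents -/

/-- Jensen's formula: the average of `log ‖a + t b‖` is `log ‖b‖ + log⁺ ‖a / b‖`, which is at least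
`log ‖a‖`. -/
lemma exists_circleIntegrable_log_norm {a : ℂ} (ha : a ≠ 0) (b : ℂ) :
    ∃ g : ℂ → ℝ, CircleIntegrable g 0 1 ∧ Real.log ‖a‖ ≤ Real.circleAverage g 0 1 ∧
      ∀ t : ℂ, a + t * b ≠ 0 → g t = Real.log ‖a + t * b‖ := by
  rcases eq_or_ne b 0 with rfl | hb
  · refine ⟨fun _ => Real.log ‖a‖, circleIntegrable_const _ _ _, ?_, fun t _ => by simp⟩
    rw [Real.circleAverage_const]
  have h1 : CircleIntegrable (fun t => Real.log ‖t - -(a / b)‖) 0 1 :=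
    circleIntegrable_log_norm_sub_const 1
  refine ⟨fun t => Real.log ‖b‖ + Real.log ‖t - -(a / b)‖,
    CircleIntegrable.add (circleIntegrable_const _ _ _) h1, ?_, fun t ht => ?_⟩
  · have h2 := Real.circleAverage_add (circleIntegrable_const (Real.log ‖b‖) 0 1) h1
    rw [Real.circleAverage_const, circleAverage_log_norm_sub_const_eq_posLog, norm_neg] at h2
    have h3 : Real.log ‖a‖ = Real.log ‖b‖ + Real.log ‖a / b‖ := by
      rw [norm_div, Real.log_div (norm_ne_zero_iff.2 ha) (norm_ne_zero_iff.2 hb)]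
      ring
    calc Real.log ‖a‖ ≤ Real.log ‖b‖ + Real.posLog ‖a / b‖ := by
          rw [h3]
          gcongr
          exact le_max_right _ _
      _ = _ := h2.symm
  · have h2 : a + t * b = b * (t - -(a / b)) := by
      field_simp
      ring
    have h3 : t - -(a / b) ≠ 0 := by
      intro h
      rw [h2, h, mul_zero] at ht
      exact ht rfl
    rw [h2, norm_mul, Real.log_mul (norm_ne_zero_iff.2 hb) (norm_ne_zero_iff.2 h3)]

/-- An affine function that is nonzero at the origin has at most one zero, and one angle is a null
set. This removes the points where `Real.log 0 = 0` differs from `-∞`. -/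
lemma ae_add_exp_mul_ne_zero {a : ℂ} (ha : a ≠ 0) (b : ℂ) :
    ∀ᵐ θ ∂(volume.restrict (Set.Ioc 0 (2 * Real.pi))), a + circleMap 0 1 θ * b ≠ 0 := by
  rw [ae_restrict_iff' measurableSet_Ioc]
  have hinj : (Set.Ioc 0 (2 * Real.pi)).InjOn (circleMap 0 1) := by
    have := injOn_circleMap_of_abs_sub_le (a := 0) (b := 2 * Real.pi) (R := 1) (c := 0)
      one_ne_zero (by simp [abs_of_pos Real.pi_pos])
    rwa [Set.uIoc_of_le Real.two_pi_pos.le] at this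
  refine measure_mono_null (t := {θ | θ ∈ Set.Ioc 0 (2 * Real.pi) ∧ a + circleMap 0 1 θ * b = 0})
    (fun θ hθ => ?_) (Set.Subsingleton.measure_zero ?_ _)
  · have : ¬(θ ∈ Set.Ioc 0 (2 * Real.pi) → a + circleMap 0 1 θ * b ≠ 0) := hθ
    push Not at this
    exact this
  · rintro θ ⟨hθ, h1⟩ φ ⟨hφ, h2⟩
    refine hinj hθ hφ ?_
    have hb : b ≠ 0 := by
      rintro rfl
      rw [mul_zero, add_zero] at h1
      exact ha h1
    have : (circleMap 0 1 θ - circleMap 0 1 φ) * b = 0 := by linear_combination h1 - h2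
    exact sub_eq_zero.1 ((mul_eq_zero.1 this).resolve_right hb)

lemma circleAverage_finset_sum {ι : Type*} (s : Finset ι) {g : ι → ℂ → ℝ}
    (hg : ∀ i ∈ s, CircleIntegrable (g i) 0 1) :
    CircleIntegrable (fun t => ∑ i ∈ s, g i t) 0 1 ∧
    Real.circleAverage (fun t => ∑ i ∈ s, g i t) 0 1 = ∑ i ∈ s, Real.circleAverage (g i) 0 1 := by
  classical
  induction s using Finset.induction_on with
  | empty => simp [Real.circleAverage_const]
  | insert i s hi ih =>
    obtain ⟨h1, h2⟩ := ih fun j hj => hg j (Finset.mem_insert_of_mem hj)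
    have h3 := hg i (Finset.mem_insert_self _ _)
    simp only [Finset.sum_insert hi]
    refine ⟨CircleIntegrable.add h3 h1, ?_⟩
    rw [← h2]
    exact Real.circleAverage_add h3 h1

/-- On a complex line the logarithm is a constant plus a nonnegative combination of functions `log
‖a j + t b j‖`, so the one-variable inequality is summed over `j`. -/
lemma isPSH_log_prod_rpow {n : ℕ} (G : Set (EuclideanSpace ℂ (Fin n))) {α : Fin n → ℝ}
    (hα : ∀ j, 0 ≤ α j) {C : ℝ} (hC : 0 < C) :
    IsPSH G fun w => ENNReal.log (ENNReal.ofReal (C * ∏ j, ‖w j‖ ^ α j)) where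
  lt_top z _ := ENNReal.log_lt_top_iff.2 ENNReal.ofReal_lt_top
  usc := by
    have h : Continuous fun w : EuclideanSpace ℂ (Fin n) => C * ∏ j, ‖w j‖ ^ α j := by
      refine continuous_const.mul (continuous_finsetProd _ fun j _ => ?_)
      exact Continuous.rpow_const (by fun_prop) fun w => Or.inr (hα j)
    exact ((ENNReal.continuous_log.comp (ENNReal.continuous_ofReal.comp h))).upperSemicontinuous
      |>.upperSemicontinuousOn _
  sub_mean a b _ := by
    have hnn : 0 ≤ C * ∏ j, ‖a j‖ ^ α j := by positivity
    rcases hnn.eq_or_lt with h0 | hpos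
    · rw [← h0, ENNReal.ofReal_zero, ENNReal.log_zero]
      exact bot_le
    -- Coordinates with `α j = 0` may vanish without harm, since `0 ^ 0 = 1`; hence the restriction
    -- to `α j ≠ 0` throughout.
    have ha : ∀ j, α j ≠ 0 → a j ≠ 0 := by
      intro j hj h
      have : ∏ j, ‖a j‖ ^ α j = 0 :=
        Finset.prod_eq_zero (Finset.mem_univ j) (by rw [h, norm_zero, Real.zero_rpow hj])
      rw [this, mul_zero] at hpos
      exact lt_irrefl _ hpos
    have hlog : ∀ w : EuclideanSpace ℂ (Fin n), (∀ j, α j ≠ 0 → w j ≠ 0) →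
        ENNReal.log (ENNReal.ofReal (C * ∏ j, ‖w j‖ ^ α j))
          = ((Real.log C + ∑ j, α j * Real.log ‖w j‖ : ℝ) : EReal) := by
      intro w hw
      have hne : ∀ j ∈ Finset.univ, ‖w j‖ ^ α j ≠ 0 := by
        intro j _
        rcases eq_or_ne (α j) 0 with h | h
        · rw [h, Real.rpow_zero]; exact one_ne_zero
        · exact (Real.rpow_pos_of_pos (norm_pos_iff.2 (hw j h)) _).ne'
      have hp : 0 < ∏ j, ‖w j‖ ^ α j :=
        Finset.prod_pos fun j hj => lt_of_le_of_ne (by positivity) (hne j hj).symm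
      rw [ENNReal.log_ofReal_of_pos (by positivity), Real.log_mul hC.ne' hp.ne',
        Real.log_prod hne]
      congr 3 with j
      rcases eq_or_ne (α j) 0 with h | h
      · simp [h]
      · rw [Real.log_rpow (norm_pos_iff.2 (hw j h))]
    have hg : ∀ j, ∃ g : ℂ → ℝ, CircleIntegrable g 0 1 ∧
        (α j ≠ 0 → Real.log ‖a j‖ ≤ Real.circleAverage g 0 1) ∧
        ∀ t : ℂ, α j ≠ 0 → a j + t * b j ≠ 0 → g t = Real.log ‖a j + t * b j‖ := by
      intro j
      rcases eq_or_ne (α j) 0 with h | h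
      · exact ⟨fun _ => 0, circleIntegrable_const _ _ _, fun h' => absurd h h',
          fun _ h' => absurd h h'⟩
      · obtain ⟨g, h1, h2, h3⟩ := exists_circleIntegrable_log_norm (ha j h) (b j)
        exact ⟨g, h1, fun _ => h2, fun t _ => h3 t⟩
    choose g hg1 hg2 hg3 using hg
    have hg1' : ∀ j, CircleIntegrable (fun t => α j * g j t) 0 1 := fun j =>
      (hg1 j).const_smul (a := α j)
    obtain ⟨hs1, hs2⟩ := circleAverage_finset_sum Finset.univ fun j _ => hg1' j
    have hall : ∀ᵐ θ ∂(volume.restrict (Set.Ioc 0 (2 * Real.pi))),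
        ∀ j, α j ≠ 0 → a j + circleMap 0 1 θ * b j ≠ 0 := by
      rw [ae_all_iff]
      intro j
      rcases eq_or_ne (α j) 0 with h | h
      · exact Filter.Eventually.of_forall fun _ h' => absurd h h'
      · filter_upwards [ae_add_exp_mul_ne_zero (ha j h) (b j)] with θ hθ _ using hθ
    rw [hlog a ha, meanEReal_eq_circleAverage
      (g := fun t => Real.log C + ∑ j, α j * g j t)
      (CircleIntegrable.add (circleIntegrable_const _ _ _) hs1) ?_]
    · rw [EReal.coe_le_coe_iff]
      have h1 := Real.circleAverage_add (circleIntegrable_const (Real.log C) 0 1) hs1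
      rw [Real.circleAverage_const, hs2] at h1
      refine le_of_le_of_eq ?_ h1.symm
      gcongr with j
      have h2 : Real.circleAverage (fun t => α j * g j t) 0 1
          = α j * Real.circleAverage (g j) 0 1 := Real.circleAverage_fun_smul (a := α j)
      rw [h2]
      rcases eq_or_ne (α j) 0 with h | h
      · simp [h]
      · exact mul_le_mul_of_nonneg_left (hg2 j h) (hα j)
    · filter_upwards [hall] with θ hθ
      have hco : ∀ j, (a + Complex.exp (θ * Complex.I) • b) j = a j + circleMap 0 1 θ * b j := by
        intro j
        simp [circleMap_zero_one]
      rw [hlog _ (fun j hj => by rw [hco]; exact hθ j hj)]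
      congr 3 with j
      rcases eq_or_ne (α j) 0 with h | h
      · simp [h]
      · rw [hco, hg3 j _ h (hθ j h)]

/-! ### The levels of a point -/

/-- The numbers `max (c / (2 p_j)) (|z_j| ^ (2 p_j))` for `j < k` and `|z_j| ^ (2 p_j)` for
`j ≥ k`. -/
def level {n : ℕ} (p : Fin n → ℝ) (k : ℕ) (c : ℝ) (z : Fin n → ℂ) (j : Fin n) : ℝ :=
  if (j : ℕ) < k then max (c / (2 * p j)) (‖z j‖ ^ (2 * p j)) else ‖z j‖ ^ (2 * p j)

/-- The product of the `|z_j| / ξ_j` for `j < k`, where `ξ_j ^ (2 p_j)` is the level of `z` at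
`j`. -/
def levelProd {n : ℕ} (p : Fin n → ℝ) (k : ℕ) (c : ℝ) (z : Fin n → ℂ) : ℝ :=
  ∏ j ∈ Finset.univ.filter (fun j : Fin n => (j : ℕ) < k),
    ‖z j‖ / level p k c z j ^ (2 * p j)⁻¹

variable {n : ℕ} {p : Fin n → ℝ} {k : ℕ} {c : ℝ}

lemma level_of_lt {z : Fin n → ℂ} {j : Fin n} (hj : (j : ℕ) < k) :
    level p k c z j = max (c / (2 * p j)) (‖z j‖ ^ (2 * p j)) := if_pos hj

lemma level_of_not_lt {z : Fin n → ℂ} {j : Fin n} (hj : ¬(j : ℕ) < k) :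
    level p k c z j = ‖z j‖ ^ (2 * p j) := if_neg hj

lemma le_level (z : Fin n → ℂ) (j : Fin n) : ‖z j‖ ^ (2 * p j) ≤ level p k c z j := by
  unfold level
  split_ifs
  · exact le_max_right _ _
  · exact le_rfl

lemma level_nonneg (z : Fin n → ℂ) (j : Fin n) : 0 ≤ level p k c z j :=
  (Real.rpow_nonneg (norm_nonneg _) _).trans (le_level z j)

lemma level_pos (hp : ∀ j, 0 < p j) (hc : 0 < c) (z : Fin n → ℂ) {j : Fin n}
    (hj : (j : ℕ) < k) : 0 < level p k c z j := by
  rw [level_of_lt hj]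
  have := hp j
  exact lt_max_of_lt_left (by positivity)

lemma level_eq_or (z : Fin n → ℂ) (j : Fin n) :
    level p k c z j = ‖z j‖ ^ (2 * p j) ∨
      ((j : ℕ) < k ∧ ‖z j‖ ^ (2 * p j) < level p k c z j ∧ level p k c z j = c / (2 * p j)) := by
  by_cases hj : (j : ℕ) < k
  · rw [level_of_lt hj]
    rcases le_or_gt (c / (2 * p j)) (‖z j‖ ^ (2 * p j)) with h | h
    · exact Or.inl (max_eq_right h)
    · rw [max_eq_left h.le]
      exact Or.inr ⟨hj, h, rfl⟩
  · exact Or.inl (level_of_not_lt hj)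

lemma rpow_two_mul_rpow_inv (hp : ∀ j, 0 < p j) {x : ℝ} (hx : 0 ≤ x) (j : Fin n) :
    (x ^ (2 * p j)) ^ (2 * p j)⁻¹ = x :=
  Real.rpow_rpow_inv hx (by have := hp j; positivity)

lemma rpow_inv_rpow_two_mul (hp : ∀ j, 0 < p j) {x : ℝ} (hx : 0 ≤ x) (j : Fin n) :
    (x ^ (2 * p j)⁻¹) ^ (2 * p j) = x :=
  Real.rpow_inv_rpow hx (by have := hp j; positivity)

lemma mem_ellipsoid {z : EuclideanSpace ℂ (Fin n)} :
    z ∈ ellipsoid p ↔ ∑ j, ‖z j‖ ^ (2 * p j) < 1 := Iff.rfl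

lemma norm_lt_one_of_mem_ellipsoid (hp : ∀ j, 0 < p j) {z : EuclideanSpace ℂ (Fin n)}
    (hz : z ∈ ellipsoid p) (j : Fin n) : ‖z j‖ < 1 := by
  have h1 : ‖z j‖ ^ (2 * p j) < 1 :=
    (Finset.single_le_sum (f := fun j => ‖z j‖ ^ (2 * p j))
      (fun i _ => Real.rpow_nonneg (norm_nonneg _) _) (Finset.mem_univ j)).trans_lt hz
  have := hp j
  exact (Real.rpow_lt_one_iff' (norm_nonneg _) (by positivity)).1 h1

lemma mem_hyperplanes {z : EuclideanSpace ℂ (Fin n)} {G : Set (EuclideanSpace ℂ (Fin n))} :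
    z ∈ hyperplanes G k ↔ z ∈ G ∧ ∃ j : Fin n, (j : ℕ) < k ∧ z j = 0 := by
  simp [hyperplanes, Finset.prod_eq_zero_iff]

/-! ### The upper bound -/

/-- Schwarz's lemma is iterated over the set `D` of coordinates that can still grow. `D` is nonempty
because the levels sum to `1` while the `|z j| ^ (2 p j)` sum to less, and this strictness keeps the
open polydisc inside the ellipsoid. -/
lemma IsSchwarzOn.le_levelProd (hp : ∀ j, 0 < p j) {u : EuclideanSpace ℂ (Fin n) → ℝ}
    (hu : IsSchwarzOn (ellipsoid p) (hyperplanes (ellipsoid p) k) u)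
    (hu1 : ∀ w ∈ ellipsoid p, u w ≤ 1) {z : EuclideanSpace ℂ (Fin n)} (hz : z ∈ ellipsoid p)
    (hc : 0 < c) (hX : ∑ j, level p k c z j = 1) : u z ≤ levelProd p k c z := by
  classical
  set X := level p k c z with hXdef
  set ξ : Fin n → ℝ := fun j => X j ^ (2 * p j)⁻¹ with hξ
  set D : Finset (Fin n) := Finset.univ.filter fun j => ‖z j‖ ^ (2 * p j) < X j with hD
  have hDK : ∀ j ∈ D, (j : ℕ) < k := by
    intro j hj
    rw [hD, Finset.mem_filter] at hj
    rcases level_eq_or (p := p) (k := k) (c := c) z j with h | h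
    · exact absurd h hj.2.ne'
    · exact h.1
  have hDnot : ∀ j ∉ D, X j = ‖z j‖ ^ (2 * p j) := by
    intro j hj
    rw [hD, Finset.mem_filter] at hj
    push Not at hj
    exact le_antisymm (hj (Finset.mem_univ j)) (le_level _ _)
  have hDne : D.Nonempty := by
    have : ∑ j, ‖z j‖ ^ (2 * p j) < ∑ j, X j := by rw [hX]; exact hz
    obtain ⟨j, hj, hlt⟩ := Finset.exists_lt_of_sum_lt this
    exact ⟨j, by simpa [hD] using hlt⟩
  have hξpow : ∀ j, ξ j ^ (2 * p j) = X j := fun j =>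
    rpow_inv_rpow_two_mul hp (level_nonneg _ _) j
  have hzD : ∀ j ∈ D, ‖z j‖ < ξ j := by
    intro j hj
    have h1 : ‖z j‖ ^ (2 * p j) < ξ j ^ (2 * p j) := by
      rw [hξpow]
      exact (Finset.mem_filter.1 hj).2
    exact (Real.rpow_lt_rpow_iff (norm_nonneg _) (Real.rpow_nonneg (level_nonneg _ _) _)
      (by have := hp j; positivity)).1 h1
  have hPE : ∀ w : EuclideanSpace ℂ (Fin n), (∀ j ∈ D, ‖w j‖ < ξ j) → (∀ j ∉ D, w j = z j) →
      w ∈ ellipsoid p := by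
    intro w h1 h2
    rw [mem_ellipsoid, ← hX]
    have h3 : ∀ j ∈ D, ‖w j‖ ^ (2 * p j) < X j := by
      intro j hj
      rw [← hξpow j]
      exact Real.rpow_lt_rpow (norm_nonneg _) (h1 j hj) (by have := hp j; positivity)
    obtain ⟨i, hi⟩ := hDne
    refine Finset.sum_lt_sum (fun j _ => ?_) ⟨i, Finset.mem_univ i, h3 i hi⟩
    by_cases hj : j ∈ D
    · exact (h3 j hj).le
    · rw [h2 j hj]
      exact le_level _ _
  -- The bound is claimed on the whole polydisc, so that the induction hypothesis supplies the
  -- constant `M` on the entire disc in the next coordinate.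
  have key : ∀ S ⊆ D, ∀ w : EuclideanSpace ℂ (Fin n), (∀ j ∈ D, ‖w j‖ < ξ j) →
      (∀ j ∉ D, w j = z j) → u w ≤ ∏ j ∈ S, ‖w j‖ / ξ j := by
    intro S
    induction S using Finset.induction_on with
    | empty =>
      intro _ w h1 h2
      simpa using hu1 w (hPE w h1 h2)
    | insert i S hi ih =>
      intro hS w h1 h2
      have hiD : i ∈ D := hS (Finset.mem_insert_self _ _)
      set a : EuclideanSpace ℂ (Fin n) := WithLp.toLp 2 (Function.update (fun j => w j) i 0)
        with ha
      have hco : ∀ (t : ℂ) (j : Fin n),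
          (a + t • EuclideanSpace.single i (1 : ℂ)) j = if j = i then t else w j := by
        intro t j
        by_cases h : j = i
        · subst h
          simp [ha]
        · simp [ha, h]
      have hP : ∀ t : ℂ, ‖t‖ < ξ i →
          (∀ j ∈ D, ‖(a + t • EuclideanSpace.single i (1 : ℂ)) j‖ < ξ j) ∧
          (∀ j ∉ D, (a + t • EuclideanSpace.single i (1 : ℂ)) j = z j) := by
        intro t ht
        constructor
        · intro j hj
          rw [hco]
          split_ifs with h
          · rwa [h]
          · exact h1 j hj
        · intro j hj
          rw [hco, if_neg (by rintro rfl; exact hj hiD)]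
          exact h2 j hj
      have haA : a ∈ hyperplanes (ellipsoid p) k := by
        have h0 : ‖(0 : ℂ)‖ < ξ i := by
          rw [norm_zero]
          exact (norm_nonneg _).trans_lt (hzD i hiD)
        have h3 := hPE _ (hP 0 h0).1 (hP 0 h0).2
        rw [zero_smul, add_zero] at h3
        exact mem_hyperplanes.2 ⟨h3, i, hDK i hiD, by simp [ha]⟩
      have h4 := hu a haA (EuclideanSpace.single i 1) (ξ i) (∏ j ∈ S, ‖w j‖ / ξ j)
        (fun t ht => hPE _ (hP t ht).1 (hP t ht).2) (fun t ht => by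
          refine (ih ((Finset.subset_insert _ _).trans hS) _ (hP t ht).1 (hP t ht).2).trans_eq ?_
          refine Finset.prod_congr rfl fun j hj => ?_
          rw [hco, if_neg (by rintro rfl; exact hi hj)]) (w i) (h1 i hiD)
      have h5 : a + w i • EuclideanSpace.single i (1 : ℂ) = w := by
        ext j
        rw [hco]
        split_ifs with h
        · rw [h]
        · rfl
      rw [h5] at h4
      rw [Finset.prod_insert hi, mul_comm]
      exact h4
  refine (key D subset_rfl z hzD fun _ _ => rfl).trans_eq ?_
  -- The coordinates `j < k` outside `D` have `ξ j = ‖z j‖` and contribute the factor `1`.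
  refine Finset.prod_subset (fun j hj => by simpa using hDK j hj) fun j hjK hj => ?_
  have hpos : 0 < X j := level_pos hp hc _ (by simpa using hjK)
  have h1 : ξ j = ‖z j‖ := by
    simp only [hξ]
    rw [hDnot j hj, rpow_two_mul_rpow_inv hp (norm_nonneg _)]
  have h2 : 0 < ξ j := Real.rpow_pos_of_pos hpos _
  rw [← h1, div_self h2.ne']

/-! ### The lower bound for the Green function -/

/-- Weighted AM-GM with the levels as weights. A level `0` is harmless: its factor is a zeroth
power, hence `1`, and its term in the arithmetic mean is `0`. -/
lemma prod_div_level_lt_one {z w : EuclideanSpace ℂ (Fin n)} (hw : w ∈ ellipsoid p)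
    (hX : ∑ j, level p k c z j = 1) :
    ∏ j, (‖w j‖ ^ (2 * p j) / level p k c z j) ^ level p k c z j < 1 := by
  refine (Real.geom_mean_le_arith_mean_weighted Finset.univ (level p k c z)
    (fun j => ‖w j‖ ^ (2 * p j) / level p k c z j) (fun j _ => level_nonneg _ j) hX
    fun j _ => div_nonneg (Real.rpow_nonneg (norm_nonneg _) _) (level_nonneg _ j)).trans_lt ?_
  refine lt_of_le_of_lt (Finset.sum_le_sum fun j _ => ?_) hw
  rcases (level_nonneg (p := p) (k := k) (c := c) z j).eq_or_lt with h | h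
  · rw [← h, zero_mul]
    exact Real.rpow_nonneg (norm_nonneg _) _
  · rw [mul_div_cancel₀ _ h.ne']

lemma exists_isGreenCompetitor_eq_levelProd (hp : ∀ j, 0 < p j) {z : EuclideanSpace ℂ (Fin n)}
    (hc : 0 < c) (hX : ∑ j, level p k c z j = 1) :
    ∃ u, IsGreenCompetitor (ellipsoid p) (hyperplanes (ellipsoid p) k) u ∧
      u z = levelProd p k c z := by
  set X := level p k c z with hXdef
  have hX0 : ∀ j, 0 ≤ X j := fun j => level_nonneg _ j
  have hXX : ∀ j, 0 < X j ^ (X j / c) := by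
    intro j
    rcases (hX0 j).eq_or_lt with h | h
    · rw [← h, zero_div, Real.rpow_zero]
      exact one_pos
    · exact Real.rpow_pos_of_pos h _
  -- These are the exponents in the `1 / c`-th power of the AM-GM product. For `j < k` they are at
  -- least `1`, because `X j ≥ c / (2 p j)`, which gives the pole condition; where the level exceeds
  -- `|z j| ^ (2 p j)` they equal `1`, and the remaining factors are `1` at `z`.
  set α : Fin n → ℝ := fun j => 2 * p j * (X j / c) with hα
  have hα0 : ∀ j, 0 ≤ α j := by
    intro j
    have := hp j
    have := hX0 j
    positivity
  set C : ℝ := (∏ j, X j ^ (X j / c))⁻¹ with hC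
  have hCpos : 0 < C := inv_pos.2 (Finset.prod_pos fun j _ => hXX j)
  have hform : ∀ w : EuclideanSpace ℂ (Fin n), C * ∏ j, ‖w j‖ ^ α j
      = ∏ j, (‖w j‖ ^ (2 * p j) / X j) ^ (X j / c) := by
    intro w
    rw [hC, ← Finset.prod_inv_distrib, ← Finset.prod_mul_distrib]
    refine Finset.prod_congr rfl fun j _ => ?_
    rw [Real.div_rpow (Real.rpow_nonneg (norm_nonneg _) _) (hX0 j), hα,
      Real.rpow_mul (norm_nonneg _)]
    ring
  refine ⟨fun w => C * ∏ j, ‖w j‖ ^ α j, ⟨fun w hw => ⟨by positivity, ?_⟩,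
    isPSH_log_prod_rpow _ hα0 hCpos, ?_⟩, ?_⟩
  · have h1 := prod_div_level_lt_one hw hX
    have h2 : ∏ j, (‖w j‖ ^ (2 * p j) / X j) ^ (X j / c)
        = (∏ j, (‖w j‖ ^ (2 * p j) / X j) ^ X j) ^ c⁻¹ := by
      rw [← Real.finsetProd_rpow _ _ fun j _ => Real.rpow_nonneg
        (div_nonneg (Real.rpow_nonneg (norm_nonneg _) _) (hX0 j)) _]
      refine Finset.prod_congr rfl fun j _ => ?_
      rw [← Real.rpow_mul (div_nonneg (Real.rpow_nonneg (norm_nonneg _) _) (hX0 j)),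
        div_eq_mul_inv (X j) c]
    rw [hform, h2]
    refine Real.rpow_lt_one (Finset.prod_nonneg fun j _ => Real.rpow_nonneg
        (div_nonneg (Real.rpow_nonneg (norm_nonneg _) _) (hX0 j)) _) h1 (by positivity)
  · intro a ha
    obtain ⟨-, i, hi, hai⟩ := mem_hyperplanes.1 ha
    refine ⟨C, hCpos, fun w hw => ?_⟩
    have hw1 : ∀ j, ‖w j‖ < 1 := norm_lt_one_of_mem_ellipsoid hp hw
    have h1 : 1 ≤ α i := by
      have h2 : c / (2 * p i) ≤ X i := by
        rw [hXdef, level_of_lt hi]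
        exact le_max_left _ _
      have := hp i
      rw [div_le_iff₀ (by positivity)] at h2
      simp only [hα]
      rw [← mul_div_assoc, le_div_iff₀ hc]
      linarith
    have h2 : ∏ j, ‖w j‖ ^ α j ≤ ‖w i‖ ^ α i := by
      rw [← Finset.mul_prod_erase _ _ (Finset.mem_univ i)]
      refine mul_le_of_le_one_right (by positivity) (Finset.prod_le_one (fun j _ => by positivity)
        fun j _ => Real.rpow_le_one (norm_nonneg _) (hw1 j).le (hα0 j))
    have h3 : ‖w i‖ ^ α i ≤ ‖w i‖ := by
      rcases (norm_nonneg (w i)).eq_or_lt with h | h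
      · rw [← h, Real.zero_rpow (by linarith)]
      · calc ‖w i‖ ^ α i ≤ ‖w i‖ ^ (1 : ℝ) := Real.rpow_le_rpow_of_exponent_ge h (hw1 i).le h1
          _ = ‖w i‖ := Real.rpow_one _
    have h4 : ‖w i‖ ≤ ‖w - a‖ := by
      have := PiLp.norm_apply_le (w - a) i
      simpa [hai] using this
    exact mul_le_mul_of_nonneg_left (h2.trans (h3.trans h4)) hCpos.le
  · refine (hform z).trans ?_
    rw [levelProd, Finset.prod_filter]
    refine Finset.prod_congr rfl fun j _ => ?_
    have hpj := hp j
    rcases level_eq_or (p := p) (k := k) (c := c) z j with h | ⟨hj, -, h⟩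
    · have h1 : (‖z j‖ ^ (2 * p j) / X j) ^ (X j / c) = 1 := by
        rcases (hX0 j).eq_or_lt with h0 | h0
        · rw [← h0, zero_div c, Real.rpow_zero]
        · rw [← h, div_self h0.ne', Real.one_rpow]
      rw [h1]
      split_ifs with hj
      · have h0 : 0 < level p k c z j := level_pos hp hc _ hj
        have h2 : level p k c z j ^ (2 * p j)⁻¹ = ‖z j‖ := by
          rw [h, rpow_two_mul_rpow_inv hp (norm_nonneg _)]
        rw [h2, div_self]
        rw [← h2]
        exact (Real.rpow_pos_of_pos h0 _).ne'
      · rfl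
    · rw [if_pos hj]
      have h1 : X j / c = (2 * p j)⁻¹ := by
        rw [hXdef, h]
        field_simp
      rw [h1, Real.div_rpow (Real.rpow_nonneg (norm_nonneg _) _) (hX0 j),
        rpow_two_mul_rpow_inv hp (norm_nonneg _)]

/-! ### Consequences for the two functions -/

lemma green_eq_levelProd (hp : ∀ j, 0 < p j) {z : EuclideanSpace ℂ (Fin n)}
    (hz : z ∈ ellipsoid p) (hc : 0 < c) (hX : ∑ j, level p k c z j = 1) :
    green (ellipsoid p) (hyperplanes (ellipsoid p) k) z = levelProd p k c z := by
  obtain ⟨u, hu, huz⟩ := exists_isGreenCompetitor_eq_levelProd hp hc hX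
  refine IsGreatest.csSup_eq ⟨⟨u, hu, huz.symm⟩, ?_⟩
  rintro x ⟨v, hv, rfl⟩
  exact hv.isSchwarzOn.le_levelProd hp (fun w hw => (hv.mem_Ico w hw).2.le) hz hc hX

lemma IsMobiusCompetitor.norm_le_levelProd (hp : ∀ j, 0 < p j) {z : EuclideanSpace ℂ (Fin n)}
    (hz : z ∈ ellipsoid p) (hc : 0 < c) (hX : ∑ j, level p k c z j = 1)
    {f : EuclideanSpace ℂ (Fin n) → ℂ}
    (hf : IsMobiusCompetitor (ellipsoid p) (hyperplanes (ellipsoid p) k) f) :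
    ‖f z‖ ≤ levelProd p k c z :=
  hf.isSchwarzOn.le_levelProd hp (fun w hw => (hf.mapsTo w hw).le) hz hc hX

lemma mobius_eq_levelProd (hp : ∀ j, 0 < p j) {z : EuclideanSpace ℂ (Fin n)}
    (hz : z ∈ ellipsoid p) (hc : 0 < c) (hX : ∑ j, level p k c z j = 1)
    (hf : (∀ j : Fin n, (j : ℕ) < k → z j ≠ 0) →
      ∃ f, IsMobiusCompetitor (ellipsoid p) (hyperplanes (ellipsoid p) k) f ∧
        ‖f z‖ = levelProd p k c z) :
    mobius (ellipsoid p) (hyperplanes (ellipsoid p) k) z = levelProd p k c z := by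
  obtain ⟨f, hf1, hf2⟩ : ∃ f, IsMobiusCompetitor (ellipsoid p) (hyperplanes (ellipsoid p) k) f ∧
      ‖f z‖ = levelProd p k c z := by
    by_cases h : ∀ j : Fin n, (j : ℕ) < k → z j ≠ 0
    · exact hf h
    · push Not at h
      obtain ⟨j, hj, hzj⟩ := h
      refine ⟨fun _ => 0, ⟨differentiableOn_const _, by simp, fun _ _ => rfl⟩, ?_⟩
      rw [norm_zero, levelProd, Finset.prod_eq_zero (i := j) (by simpa using hj) (by simp [hzj])]
  refine IsGreatest.csSup_eq ⟨⟨f, hf1, hf2.symm⟩, ?_⟩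
  rintro x ⟨g, hg, rfl⟩
  exact hg.norm_le_levelProd hp hz hc hX

/-! ### The Möbius function under a convexity assumption -/

/-- The supporting real hyperplane of the convex function `|w| ^ (2 p)`, `p ≥ 1 / 2`. -/
lemma rpow_mul_re_le {p : ℝ} (hp : 1 / 2 ≤ p) {z : ℂ} (hz : z ≠ 0) (w : ℂ) :
    ‖z‖ ^ (2 * p) * (1 + 2 * (p : ℂ) * (w / z - 1)).re ≤ ‖w‖ ^ (2 * p) := by
  have hz' : 0 < ‖z‖ := norm_pos_iff.2 hz
  have h1 : 1 + 2 * p * (‖w / z‖ - 1) ≤ (1 + (‖w / z‖ - 1)) ^ (2 * p) :=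
    one_add_mul_self_le_rpow_one_add (by linarith [norm_nonneg (w / z)]) (by linarith)
  have h2 : (1 + 2 * (p : ℂ) * (w / z - 1)).re = 1 + 2 * p * ((w / z).re - 1) := by
    have : (2 * (p : ℂ)) = ((2 * p : ℝ) : ℂ) := by push_cast; ring
    rw [this, Complex.add_re, Complex.re_ofReal_mul]
    simp
  have h3 : (w / z).re ≤ ‖w / z‖ := Complex.re_le_norm _
  have h4 : ‖w‖ ^ (2 * p) = ‖z‖ ^ (2 * p) * (1 + (‖w / z‖ - 1)) ^ (2 * p) := by
    rw [add_sub_cancel, ← Real.mul_rpow hz'.le (norm_nonneg _), ← norm_mul, mul_div_cancel₀ _ hz]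
  rw [h4, h2]
  refine mul_le_mul_of_nonneg_left (le_trans ?_ h1) (by positivity)
  nlinarith

lemma differentiable_prod_coord_div (s : Finset (Fin n)) (ξ : Fin n → ℂ) :
    Differentiable ℂ fun w : EuclideanSpace ℂ (Fin n) => ∏ j ∈ s, w j / ξ j := by
  classical
  induction s using Finset.induction_on with
  | empty => simp
  | insert i s hi ih =>
    simp only [Finset.prod_insert hi]
    exact Differentiable.mul (by fun_prop) ih

/-- The affine `L` satisfies `Re L > ∑ e j |w j| ^ (2 p j)` on the ellipsoid, and AM-GM over `j < k`
bounds `∏ |w j| / ξ j` by the `q`-th power of this sum divided by `c q`. So multiplying the monomial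
by `(L / (c q)) ^ (-q)` keeps the modulus below `1`, and `L z = c q` makes the bound sharp. -/
lemma exists_isMobiusCompetitor_of_convex (hp : ∀ j, 0 < p j)
    {z : EuclideanSpace ℂ (Fin n)} (hc : 0 < c) (hX : ∑ j, level p k c z j = 1)
    (hk : ∃ j : Fin n, (j : ℕ) < k)
    (hconv : ∀ j : Fin n, ¬((j : ℕ) < k ∧ level p k c z j = c / (2 * p j)) → z j ≠ 0 →
      1 / 2 ≤ p j) :
    ∃ f, IsMobiusCompetitor (ellipsoid p) (hyperplanes (ellipsoid p) k) f ∧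
      ‖f z‖ = levelProd p k c z := by
  set X := level p k c z with hXdef
  set K : Finset (Fin n) := Finset.univ.filter (fun j : Fin n => (j : ℕ) < k) with hK
  have hX0 : ∀ j, 0 ≤ X j := fun j => level_nonneg _ j
  have hXK : ∀ j ∈ K, 0 < X j := fun j hj => level_pos hp hc _ (by simpa [hK] using hj)
  -- The share of `|w j| ^ (2 p j)` that AM-GM consumes; the rest, `1 - e j`, is replaced by its
  -- supporting affine function. It is `1` at a level `c / (2 p j)` with `j < k`, so no convexity is
  -- needed there.
  set e : Fin n → ℝ := fun j => if (j : ℕ) < k then c / (2 * p j * X j) else 0 with he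
  have he0 : ∀ j, 0 ≤ e j := by
    intro j
    have := hp j
    have := hX0 j
    simp only [he]
    split_ifs <;> positivity
  have he1 : ∀ j, e j ≤ 1 := by
    intro j
    simp only [he]
    split_ifs with hj
    · have h1 : 0 < X j := hXK j (by simpa [hK] using hj)
      have h2 := hp j
      have h3 : c / (2 * p j) ≤ X j := by
        rw [hXdef, level_of_lt hj]
        exact le_max_left _ _
      rw [← div_div, div_le_one h1]
      exact h3
    · exact zero_le_one
  have hcase : ∀ j, e j = 1 ∨ (X j = ‖z j‖ ^ (2 * p j) ∧ (z j ≠ 0 → 1 / 2 ≤ p j)) := by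
    intro j
    by_cases h : (j : ℕ) < k ∧ level p k c z j = c / (2 * p j)
    · left
      have := hp j
      simp only [he]
      rw [if_pos h.1, hXdef, h.2]
      field_simp
    · right
      refine ⟨?_, hconv j h⟩
      rcases level_eq_or (p := p) (k := k) (c := c) z j with h' | h'
      · exact h'
      · exact absurd ⟨h'.1, h'.2.2⟩ h
  set q : ℝ := ∑ j ∈ K, (2 * p j)⁻¹ with hq
  have hqpos : 0 < q := by
    obtain ⟨i, hi⟩ := hk
    exact Finset.sum_pos (fun j _ => inv_pos.2 (by have := hp j; positivity)) ⟨i, by simpa [hK]⟩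
  -- For `z j = 0` the coefficient `‖z j‖ ^ (2 * p j)` vanishes, so the division by `z j` does not
  -- matter.
  set L : EuclideanSpace ℂ (Fin n) → ℂ := fun w => 1 - ∑ j,
    (((1 - e j) * ‖z j‖ ^ (2 * p j) : ℝ) : ℂ) * (1 + 2 * (p j : ℂ) * (w j / z j - 1)) with hL
  have hLre : ∀ w ∈ ellipsoid p, ∑ j, e j * ‖w j‖ ^ (2 * p j) < (L w).re := by
    intro w hw
    have h1 : (L w).re = 1 - ∑ j, (1 - e j) * (‖z j‖ ^ (2 * p j) *
        (1 + 2 * (p j : ℂ) * (w j / z j - 1)).re) := by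
      simp only [hL]
      rw [Complex.sub_re, Complex.re_sum, Complex.one_re]
      congr 2 with j
      rw [Complex.re_ofReal_mul]
      ring
    have h2 : ∑ j, (1 - e j) * (‖z j‖ ^ (2 * p j) *
        (1 + 2 * (p j : ℂ) * (w j / z j - 1)).re) ≤ ∑ j, (1 - e j) * ‖w j‖ ^ (2 * p j) := by
      refine Finset.sum_le_sum fun j _ => ?_
      rcases hcase j with h | ⟨-, h⟩
      · simp [h]
      refine mul_le_mul_of_nonneg_left ?_ (by linarith [he1 j])
      rcases eq_or_ne (z j) 0 with h0 | h0
      · rw [h0, norm_zero, Real.zero_rpow (by have := hp j; positivity), zero_mul]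
        exact Real.rpow_nonneg (norm_nonneg _) _
      · exact rpow_mul_re_le (h h0) h0 (w j)
    have h3 : ∑ j, (1 - e j) * ‖w j‖ ^ (2 * p j)
        = ∑ j, ‖w j‖ ^ (2 * p j) - ∑ j, e j * ‖w j‖ ^ (2 * p j) := by
      rw [← Finset.sum_sub_distrib]
      exact Finset.sum_congr rfl fun j _ => by ring
    have h4 := mem_ellipsoid.1 hw
    linarith
  have hLz : L z = ((c * q : ℝ) : ℂ) := by
    have h1 : ∀ j, (((1 - e j) * ‖z j‖ ^ (2 * p j) : ℝ) : ℂ) *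
        (1 + 2 * (p j : ℂ) * (z j / z j - 1)) = ((X j - e j * X j : ℝ) : ℂ) := by
      intro j
      have hpj := hp j
      rcases hcase j with h | ⟨h, -⟩
      · rw [h]; simp
      · rcases eq_or_ne (z j) 0 with h0 | h0
        · rw [h, h0, norm_zero, Real.zero_rpow (by positivity)]; simp
        · rw [div_self h0, h]
          push_cast
          ring
    have h2 : ∑ j, e j * X j = c * q := by
      rw [hq, hK, Finset.sum_filter, Finset.mul_sum]
      refine Finset.sum_congr rfl fun j _ => ?_
      simp only [he]
      split_ifs with hj
      · have := hXK j (by simpa [hK] using hj)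
        have := hp j
        field_simp
      · simp
    simp only [hL, h1]
    rw [← Complex.ofReal_sum, Finset.sum_sub_distrib, hX, h2]
    push_cast
    ring
  have hS0 : ∀ w : EuclideanSpace ℂ (Fin n), 0 ≤ ∑ j, e j * ‖w j‖ ^ (2 * p j) := fun w =>
    Finset.sum_nonneg fun j _ => mul_nonneg (he0 j) (Real.rpow_nonneg (norm_nonneg _) _)
  set ξ : Fin n → ℝ := fun j => X j ^ (2 * p j)⁻¹ with hξ
  have hξ0 : ∀ j, 0 ≤ ξ j := fun j => Real.rpow_nonneg (hX0 j) _
  have hprod : ∀ w : EuclideanSpace ℂ (Fin n), ∏ j ∈ K, ‖w j‖ / ξ j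
      ≤ ((∑ j, e j * ‖w j‖ ^ (2 * p j)) / (c * q)) ^ q := by
    intro w
    have hy : ∀ j, 0 ≤ ‖w j‖ ^ (2 * p j) / X j := fun j =>
      div_nonneg (Real.rpow_nonneg (norm_nonneg _) _) (hX0 j)
    have h1 := Real.geom_mean_le_arith_mean_weighted K (fun j => (2 * p j)⁻¹ / q)
      (fun j => ‖w j‖ ^ (2 * p j) / X j)
      (fun j _ => div_nonneg (inv_nonneg.2 (by have := hp j; positivity)) hqpos.le)
      (by rw [← Finset.sum_div, ← hq, div_self hqpos.ne']) fun j _ => hy j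
    have h2 : ∑ j ∈ K, (2 * p j)⁻¹ / q * (‖w j‖ ^ (2 * p j) / X j)
        = (∑ j, e j * ‖w j‖ ^ (2 * p j)) / (c * q) := by
      rw [hK, Finset.sum_filter, Finset.sum_div]
      refine Finset.sum_congr rfl fun j _ => ?_
      simp only [he]
      split_ifs with hj
      · have := hXK j (by simpa [hK] using hj)
        have := hp j
        field_simp
      · simp
    have h3 : ∏ j ∈ K, ‖w j‖ / ξ j
        = (∏ j ∈ K, (‖w j‖ ^ (2 * p j) / X j) ^ ((2 * p j)⁻¹ / q)) ^ q := by
      rw [← Real.finsetProd_rpow _ _ fun j _ => Real.rpow_nonneg (hy j) _]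
      refine Finset.prod_congr rfl fun j _ => ?_
      rw [← Real.rpow_mul (hy j), div_mul_cancel₀ _ hqpos.ne',
        Real.div_rpow (Real.rpow_nonneg (norm_nonneg _) _) (hX0 j),
        rpow_two_mul_rpow_inv hp (norm_nonneg _)]
    rw [h3, ← h2]
    exact Real.rpow_le_rpow (Finset.prod_nonneg fun j _ => Real.rpow_nonneg (hy j) _) h1 hqpos.le
  have hcq : 0 < c * q := mul_pos hc hqpos
  -- Positive real part makes the principal branch of the power holomorphic.
  have hslit : ∀ w ∈ ellipsoid p, 0 < (L w / ((c * q : ℝ) : ℂ)).re := by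
    intro w hw
    rw [Complex.div_ofReal_re]
    exact div_pos ((hS0 w).trans_lt (hLre w hw)) hcq
  set f : EuclideanSpace ℂ (Fin n) → ℂ := fun w =>
    (∏ j ∈ K, w j / (ξ j : ℂ)) * (L w / ((c * q : ℝ) : ℂ)) ^ ((-q : ℝ) : ℂ) with hf
  have hfn : ∀ w, ‖f w‖ = (∏ j ∈ K, ‖w j‖ / ξ j) * (‖L w‖ / (c * q)) ^ (-q) := by
    intro w
    simp only [hf]
    rw [norm_mul, norm_prod, Complex.norm_cpow_real, norm_div, Complex.norm_real,
      Real.norm_of_nonneg hcq.le]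
    congr 1
    refine Finset.prod_congr rfl fun j _ => ?_
    rw [norm_div, Complex.norm_real, Real.norm_of_nonneg (hξ0 j)]
  refine ⟨f, ⟨?_, fun w hw => ?_, fun a ha => ?_⟩, ?_⟩
  · refine DifferentiableOn.mul
      (differentiable_prod_coord_div K _).differentiableOn (DifferentiableOn.cpow ?_
      (differentiableOn_const _) fun w hw => Or.inl (hslit w hw))
    refine Differentiable.differentiableOn ?_
    fun_prop
  · have h1 := (hLre w hw).trans_le (Complex.re_le_norm _)
    have hLpos : 0 < ‖L w‖ := (hS0 w).trans_lt h1
    rw [hfn]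
    calc (∏ j ∈ K, ‖w j‖ / ξ j) * (‖L w‖ / (c * q)) ^ (-q)
        ≤ ((∑ j, e j * ‖w j‖ ^ (2 * p j)) / (c * q)) ^ q * (‖L w‖ / (c * q)) ^ (-q) := by
          gcongr
          exact hprod w
      _ < (‖L w‖ / (c * q)) ^ q * (‖L w‖ / (c * q)) ^ (-q) := by
          refine mul_lt_mul_of_pos_right ?_ (Real.rpow_pos_of_pos (by positivity) _)
          refine Real.rpow_lt_rpow (div_nonneg (hS0 w) hcq.le) ?_ hqpos
          gcongr
      _ = 1 := by
          rw [← Real.rpow_add (by positivity), add_neg_cancel, Real.rpow_zero]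
  · obtain ⟨-, i, hi, hai⟩ := mem_hyperplanes.1 ha
    simp only [hf]
    rw [Finset.prod_eq_zero (i := i) (by simpa [hK] using hi) (by simp [hai]), zero_mul]
  · rw [hfn, hLz, Complex.norm_real, Real.norm_of_nonneg hcq.le, div_self hcq.ne', Real.one_rpow,
      mul_one]
    rfl

/-! ### The explicit formula -/

lemma qSum_succ (i : Fin n) : qSum p (i + 1) = qSum p i + (2 * p i)⁻¹ := by
  have : Finset.univ.filter (fun j : Fin n => (j : ℕ) < (i : ℕ) + 1)
      = insert i (Finset.univ.filter (fun j : Fin n => (j : ℕ) < (i : ℕ))) := by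
    ext j
    simp only [Finset.mem_filter, Finset.mem_univ, true_and, Finset.mem_insert, Fin.ext_iff]
    omega
  rw [qSum, this, Finset.sum_insert (by simp), qSum, add_comm]

lemma rRem_succ (z : Fin n → ℂ) (i : Fin n) :
    rRem p (i + 1) z = rRem p i z + ‖z i‖ ^ (2 * p i) := by
  have : Finset.univ.filter (fun j : Fin n => (i : ℕ) ≤ (j : ℕ))
      = insert i (Finset.univ.filter (fun j : Fin n => (i : ℕ) + 1 ≤ (j : ℕ))) := by
    ext j
    simp only [Finset.mem_filter, Finset.mem_univ, true_and, Finset.mem_insert, Fin.ext_iff]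
    omega
  rw [rRem, rRem, this, Finset.sum_insert (by simp)]
  ring

lemma rRem_pos {z : Fin n → ℂ} (hz : ∑ j, ‖z j‖ ^ (2 * p j) < 1) (s : ℕ) : 0 < rRem p s z := by
  have : ∑ j ∈ Finset.univ.filter (fun j : Fin n => s ≤ (j : ℕ)), ‖z j‖ ^ (2 * p j)
      ≤ ∑ j, ‖z j‖ ^ (2 * p j) :=
    Finset.sum_le_sum_of_subset_of_nonneg (Finset.filter_subset _ _)
      fun j _ _ => Real.rpow_nonneg (norm_nonneg _) _
  rw [rRem]
  linarith

lemma qSum_nonneg (hp : ∀ j, 0 < p j) (s : ℕ) : 0 ≤ qSum p s :=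
  Finset.sum_nonneg fun j _ => inv_nonneg.2 (by have := hp j; positivity)

/-- With `c = c_d(z)`, sortedness and the maximality of `d` show that the maximum defining the level
is `c / (2 p j)` for the first `d` coordinates and `|z j| ^ (2 p j)` for the others. -/
lemma formulaR_eq_levelProd_of_sorted (hp : ∀ j, 0 < p j) (hk : 1 ≤ k) (hkn : k ≤ n)
    {z : Fin n → ℂ} (hz : ∑ j, ‖z j‖ ^ (2 * p j) < 1)
    (hmono : ∀ i j : Fin n, i ≤ j → (j : ℕ) < k →
      p i * ‖z i‖ ^ (2 * p i) ≤ p j * ‖z j‖ ^ (2 * p j)) :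
    ∃ c, 0 < c ∧ ∑ j, level p k c z j = 1 ∧ formulaR p k z = levelProd p k c z := by
  set S : Set ℕ := {s : ℕ | s ≤ k ∧ ∃ i : Fin n, s = (i : ℕ) + 1 ∧
    2 * p i * ‖z i‖ ^ (2 * p i) ≤ cQuot p s z} with hS
  have hbdd : BddAbove S := ⟨k, fun s hs => hs.1⟩
  -- Passing from `s - 1` to `s` adds `|z_s| ^ (2 p_s)` to `r` and `1 / (2 p_s)` to `q`, so the test
  -- against `c_s` is equivalent to the same test against `r_{s-1} / q_{s-1}`. Hence failure at `d +
  -- 1` is a comparison with `c_d` itself.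
  have hmemiff : ∀ i : Fin n, (i : ℕ) < k → ((i : ℕ) + 1 ∈ S ↔
      2 * p i * ‖z i‖ ^ (2 * p i) * qSum p i ≤ rRem p i z) := by
    intro i hi
    have hpi := hp i
    have hq := qSum_nonneg hp (i : ℕ)
    have h1 : 2 * p i * ‖z i‖ ^ (2 * p i) ≤ cQuot p ((i : ℕ) + 1) z ↔
        2 * p i * ‖z i‖ ^ (2 * p i) * qSum p i ≤ rRem p i z := by
      rw [cQuot, qSum_succ, rRem_succ, le_div_iff₀ (by positivity), mul_add]
      have : 2 * p i * ‖z i‖ ^ (2 * p i) * (2 * p i)⁻¹ = ‖z i‖ ^ (2 * p i) := by field_simp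
      rw [this, add_le_add_iff_right]
    rw [← h1]
    constructor
    · rintro ⟨-, i', hi', h⟩
      have : i' = i := Fin.ext (by omega)
      rwa [this] at h
    · intro h
      exact ⟨hi, i, rfl, h⟩
  have hone : 1 ∈ S := by
    have h0 := (hmemiff ⟨0, by omega⟩ (by simp; omega)).2 (by
      simp only [qSum]
      simpa using (rRem_pos hz 0).le)
    simpa using h0
  set d := dMax p k z with hd
  have hdS : d ∈ S := Nat.sSup_mem ⟨1, hone⟩ hbdd
  have hd1 : 1 ≤ d := le_csSup hbdd hone
  have hdk : d ≤ k := hdS.1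
  set c := cQuot p d z with hc
  have hqd : 0 < qSum p d := by
    refine Finset.sum_pos (fun j _ => inv_pos.2 (by have := hp j; positivity))
      ⟨⟨0, by omega⟩, by simp; omega⟩
  have hrd := rRem_pos hz d
  have hcpos : 0 < c := div_pos hrd hqd
  have hlow : ∀ j : Fin n, (j : ℕ) < d → ‖z j‖ ^ (2 * p j) ≤ c / (2 * p j) := by
    intro j hj
    obtain ⟨-, i, hi, hle⟩ := hdS
    have := hp j
    rw [le_div_iff₀ (by positivity)]
    have h1 := hmono j i (by rw [Fin.le_def]; omega) (by omega)
    linarith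
  have hhigh : ∀ j : Fin n, d ≤ (j : ℕ) → (j : ℕ) < k → c / (2 * p j) ≤ ‖z j‖ ^ (2 * p j) := by
    intro j hj hjk
    have hdn : d < n := by omega
    have hdnot : (((⟨d, hdn⟩ : Fin n) : ℕ)) + 1 ∉ S := fun h => by
      have : d + 1 ≤ d := le_csSup hbdd h
      omega
    rw [hmemiff ⟨d, hdn⟩ (by simp; omega), not_le] at hdnot
    have h1 := hmono ⟨d, hdn⟩ j (by rw [Fin.le_def]; exact hj) hjk
    have := hp j
    rw [div_le_iff₀ (by positivity), hc, cQuot, div_le_iff₀ hqd]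
    simp only at hdnot
    nlinarith
  have hlevel : ∀ j, level p k c z j
      = if (j : ℕ) < d then c / (2 * p j) else ‖z j‖ ^ (2 * p j) := by
    intro j
    split_ifs with hj
    · rw [level_of_lt (by omega), max_eq_left (hlow j hj)]
    · by_cases hjk : (j : ℕ) < k
      · rw [level_of_lt hjk, max_eq_right (hhigh j (by omega) hjk)]
      · exact level_of_not_lt hjk
  refine ⟨c, hcpos, ?_, ?_⟩
  · simp only [hlevel]
    rw [Finset.sum_ite]
    have h1 : ∑ j ∈ Finset.univ.filter (fun j : Fin n => (j : ℕ) < d), c / (2 * p j)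
        = rRem p d z := by
      have : c * qSum p d = rRem p d z := by rw [hc, cQuot, div_mul_cancel₀ _ hqd.ne']
      rw [← this, qSum, Finset.mul_sum]
      rfl
    rw [h1, rRem]
    simp only [not_lt]
    ring
  · rw [formulaR, levelProd, Finset.prod_filter, Finset.prod_filter]
    refine Finset.prod_congr rfl fun j _ => ?_
    have hpj := hp j
    rw [hlevel]
    by_cases hj : (j : ℕ) < d
    · rw [if_pos hj, if_pos (by omega), if_pos hj, one_div, ← inv_div c,
        Real.inv_rpow (by positivity), div_eq_mul_inv ‖z j‖]
    · rw [if_neg hj, if_neg hj]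
      split_ifs with hjk
      · have h1 : 0 < ‖z j‖ ^ (2 * p j) :=
          lt_of_lt_of_le (by positivity) (hhigh j (by omega) hjk)
        rw [rpow_two_mul_rpow_inv hp (norm_nonneg _), div_self]
        intro h0
        rw [h0, Real.zero_rpow (by positivity)] at h1
        exact lt_irrefl _ h1
      · rfl

lemma perm_lt_iff {σ : Equiv.Perm (Fin n)} (hσ : ∀ j : Fin n, k ≤ (j : ℕ) → σ j = j)
    (j : Fin n) : (σ j : ℕ) < k ↔ (j : ℕ) < k := by
  constructor
  · intro h
    by_contra hj
    rw [hσ j (by omega)] at h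
    exact hj h
  · intro h
    by_contra hj
    have := σ.injective (hσ (σ j) (by omega))
    rw [this] at hj
    exact hj h

/-- Levels are carried along by permutations of the first `k` coordinates. Uniqueness of `c` is not
needed, since `green_eq_levelProd` holds for every admissible `c`. -/
lemma exists_level_of_isSorting (hp : ∀ j, 0 < p j) (hk : 1 ≤ k) (hkn : k ≤ n)
    {z : Fin n → ℂ} (hz : ∑ j, ‖z j‖ ^ (2 * p j) < 1) {σ : Equiv.Perm (Fin n)}
    (hσ : IsSorting p k z σ) :
    ∃ c, 0 < c ∧ ∑ j, level p k c z j = 1 ∧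
      formulaR (fun j => p (σ j)) k (fun j => z (σ j)) = levelProd p k c z := by
  obtain ⟨c, hc, h1, h2⟩ := formulaR_eq_levelProd_of_sorted (p := fun j => p (σ j))
    (z := fun j => z (σ j)) (fun j => hp _) hk hkn
    (by rwa [Equiv.sum_comp σ fun j => ‖z j‖ ^ (2 * p j)]) hσ.2
  have hlevel : ∀ j, level (fun j => p (σ j)) k c (fun j => z (σ j)) j = level p k c z (σ j) := by
    intro j
    simp only [level, perm_lt_iff hσ.1]
  refine ⟨c, hc, ?_, ?_⟩
  · rw [← h1, ← Equiv.sum_comp σ]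
    exact Finset.sum_congr rfl fun j _ => (hlevel j).symm
  · rw [h2, levelProd, levelProd, Finset.prod_filter, Finset.prod_filter]
    refine Eq.trans ?_ (Equiv.prod_comp σ _)
    simp only [perm_lt_iff hσ.1, hlevel]

lemma exists_level (hp : ∀ j, 0 < p j) (hk : 1 ≤ k) (hkn : k ≤ n)
    {z : Fin n → ℂ} (hz : ∑ j, ‖z j‖ ^ (2 * p j) < 1) :
    ∃ c, 0 < c ∧ ∑ j, level p k c z j = 1 := by
  obtain ⟨σ, hσ⟩ := exists_isSorting p hkn z
  obtain ⟨c, hc, h, -⟩ := exists_level_of_isSorting hp hk hkn hz hσ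
  exact ⟨c, hc, h⟩

lemma green_equalsR (hp : ∀ j, 0 < p j) (hk : 1 ≤ k) (hkn : k ≤ n) :
    EqualsR p k (green (ellipsoid p) (hyperplanes (ellipsoid p) k)) := by
  intro z hz σ hσ
  obtain ⟨c, hc, hX, h⟩ := exists_level_of_isSorting hp hk hkn hz hσ
  rw [h]
  exact green_eq_levelProd hp hz hc hX

/-- The Möbius function agrees with the Green function and with the explicit formula as soon as
it attains the upper bound. -/
lemma mobius_eqOn_green_and_equalsR (hp : ∀ j, 0 < p j) (hk : 1 ≤ k) (hkn : k ≤ n)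
    (h : ∀ z ∈ ellipsoid p, ∀ c, 0 < c → ∑ j, level p k c z j = 1 →
      (∀ j : Fin n, (j : ℕ) < k → z j ≠ 0) →
      ∃ f, IsMobiusCompetitor (ellipsoid p) (hyperplanes (ellipsoid p) k) f ∧
        ‖f z‖ = levelProd p k c z) :
    Set.EqOn (mobius (ellipsoid p) (hyperplanes (ellipsoid p) k))
      (green (ellipsoid p) (hyperplanes (ellipsoid p) k)) (ellipsoid p) ∧
    EqualsR p k (mobius (ellipsoid p) (hyperplanes (ellipsoid p) k)) := by
  have heq : Set.EqOn (mobius (ellipsoid p) (hyperplanes (ellipsoid p) k))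
      (green (ellipsoid p) (hyperplanes (ellipsoid p) k)) (ellipsoid p) := by
    intro z hz
    obtain ⟨c, hc, hX⟩ := exists_level hp hk hkn hz
    rw [green_eq_levelProd hp hz hc hX, mobius_eq_levelProd hp hz hc hX (h z hz c hc hX)]
  exact ⟨heq, fun z hz σ hσ => (heq hz).trans (green_equalsR hp hk hkn z hz σ hσ)⟩

/-! ### The Möbius function in dimension two -/

lemma hasDerivAt_rpow_two_mul (p : ℝ) {t : ℝ} (ht : 0 < t) :
    HasDerivAt (fun t : ℝ => t ^ (2 * p)) (2 * p * t ^ (2 * p) / t) t := by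
  have h := Real.hasDerivAt_rpow_const (x := t) (p := 2 * p) (Or.inl ht.ne')
  rwa [Real.rpow_sub_one ht.ne', ← mul_div_assoc] at h

lemma rpow_two_mul_mem_Ioo {p t : ℝ} (hp : 0 < p) (ht : t ∈ Set.Ioo (0 : ℝ) 1) :
    t ^ (2 * p) ∈ Set.Ioo (0 : ℝ) 1 :=
  ⟨Real.rpow_pos_of_pos ht.1 _, Real.rpow_lt_one ht.1.le ht.2 (by positivity)⟩

/-- Minus the derivative of `log t + b log (1 - t ^ (2 p))`. -/
def logSlope (p b t : ℝ) : ℝ := (2 * p * b * (t ^ (2 * p) / (1 - t ^ (2 * p))) - 1) / t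

/-- With `x = t ^ (2 p)`, the sign of the derivative is that of a quadratic polynomial in `1 - x`;
completing the square leaves a positive multiple of `4 - (1 - 2 p) ^ 2 b`. -/
lemma monotoneOn_logSlope {p b : ℝ} (hp : 0 < p) (hb : 0 < b) (h : (1 - 2 * p) ^ 2 * b < 4) :
    MonotoneOn (logSlope p b) (Set.Ioo 0 1) := by
  have hderiv : ∀ t ∈ Set.Ioo (0 : ℝ) 1, HasDerivAt (logSlope p b)
      (((2 * p * b * ((2 * p * t ^ (2 * p) / t * (1 - t ^ (2 * p))
        - t ^ (2 * p) * (-(2 * p * t ^ (2 * p) / t))) / (1 - t ^ (2 * p)) ^ 2)) * t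
        - (2 * p * b * (t ^ (2 * p) / (1 - t ^ (2 * p))) - 1) * 1) / t ^ 2) t := by
    intro t ht
    have hx := rpow_two_mul_mem_Ioo hp ht
    have h1 := hasDerivAt_rpow_two_mul p ht.1
    exact (((h1.div (h1.const_sub 1) (by linarith [hx.2])).const_mul (2 * p * b)).sub_const 1).div
      (hasDerivAt_id t) ht.1.ne'
  refine monotoneOn_of_deriv_nonneg (convex_Ioo 0 1)
    (fun t ht => (hderiv t ht).continuousAt.continuousWithinAt) (fun t ht => ?_) fun t ht => ?_
  · rw [interior_Ioo] at ht
    exact (hderiv t ht).differentiableAt.differentiableWithinAt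
  · rw [interior_Ioo] at ht
    rw [(hderiv t ht).deriv]
    obtain ⟨hx0, hx1⟩ := rpow_two_mul_mem_Ioo hp ht
    set x := t ^ (2 * p)
    have ht0 := ht.1
    have h1x : 0 < 1 - x := by linarith
    refine div_nonneg ?_ (by positivity)
    have heq : (2 * p * b * ((2 * p * x / t * (1 - x)
        - x * (-(2 * p * x / t))) / (1 - x) ^ 2)) * t - (2 * p * b * (x / (1 - x)) - 1) * 1
        = ((2 * p * b) * x * (2 * p - (1 - x)) + (1 - x) ^ 2) / (1 - x) ^ 2 := by
      field_simp
      ring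
    rw [heq]
    refine div_nonneg ?_ (by positivity)
    have h2 : 0 ≤ 4 * (1 + 2 * p * b) * (2 * p * b * x * (2 * p - (1 - x)) + (1 - x) ^ 2) := by
      have h3 : 4 * (1 + 2 * p * b) * (2 * p * b * x * (2 * p - (1 - x)) + (1 - x) ^ 2)
          = (2 * (1 + 2 * p * b) * (1 - x) - 2 * p * b * (1 + 2 * p)) ^ 2
            + 2 * p * b * (2 * p) * (4 - (1 - 2 * p) ^ 2 * b) := by ring
      have h4 : 0 < 4 - (1 - 2 * p) ^ 2 * b := by linarith
      rw [h3]
      positivity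
    exact nonneg_of_mul_nonneg_right h2 (by positivity)

/-- A concave function lies below its tangent, here the tangent at `z`. -/
lemma log_add_log_one_sub_le {p b z t : ℝ} (hp : 0 < p) (hb : 0 < b)
    (h : (1 - 2 * p) ^ 2 * b < 4) (hz : z ∈ Set.Ioo (0 : ℝ) 1) (ht : t ∈ Set.Ioo (0 : ℝ) 1) :
    Real.log t + b * Real.log (1 - t ^ (2 * p)) + logSlope p b z * t
      ≤ Real.log z + b * Real.log (1 - z ^ (2 * p)) + logSlope p b z * z := by
  set m := logSlope p b z with hm
  set ψ : ℝ → ℝ := fun t => Real.log t + b * Real.log (1 - t ^ (2 * p)) + m * t with hψ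
  have hderiv : ∀ t ∈ Set.Ioo (0 : ℝ) 1, HasDerivAt ψ (m - logSlope p b t) t := by
    intro t ht
    obtain ⟨hx0, hx1⟩ := rpow_two_mul_mem_Ioo hp ht
    have ht0 := ht.1
    have h1x : 0 < 1 - t ^ (2 * p) := by linarith
    have h1 := ((Real.hasDerivAt_log ht0.ne').add
      (((hasDerivAt_rpow_two_mul p ht0).const_sub 1).log h1x.ne' |>.const_mul b)).add
      ((hasDerivAt_id t).const_mul m)
    refine h1.congr_deriv ?_
    simp only [logSlope]
    field_simp
    ring
  have hmono := monotoneOn_logSlope hp hb h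
  show ψ t ≤ ψ z
  rcases le_total t z with htz | hzt
  · have hsub : Set.Icc t z ⊆ Set.Ioo 0 1 := Set.Icc_subset_Ioo ht.1 hz.2
    refine monotoneOn_of_deriv_nonneg (convex_Icc t z)
      (fun s hs => (hderiv s (hsub hs)).continuousAt.continuousWithinAt)
      (fun s hs => (hderiv s (hsub (interior_subset hs))).differentiableAt.differentiableWithinAt)
      (fun s hs => ?_) ⟨le_rfl, htz⟩ ⟨htz, le_rfl⟩ htz
    have hs' := interior_subset hs
    rw [(hderiv s (hsub hs')).deriv]
    linarith [hmono (hsub hs') hz hs'.2]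
  · have hsub : Set.Icc z t ⊆ Set.Ioo 0 1 := Set.Icc_subset_Ioo hz.1 ht.2
    refine antitoneOn_of_deriv_nonpos (convex_Icc z t)
      (fun s hs => (hderiv s (hsub hs)).continuousAt.continuousWithinAt)
      (fun s hs => (hderiv s (hsub (interior_subset hs))).differentiableAt.differentiableWithinAt)
      (fun s hs => ?_) ⟨le_rfl, hzt⟩ ⟨hzt, le_rfl⟩ hzt
    have hs' := interior_subset hs
    rw [(hderiv s (hsub hs')).deriv]
    linarith [hmono hz (hsub hs') hs'.1]

lemma sum_fin_two_of_ne {M : Type*} [AddCommMonoid M] {i j : Fin 2} (hij : i ≠ j)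
    (F : Fin 2 → M) : ∑ l, F l = F i + F j :=
  Fintype.sum_eq_add i j hij fun l ⟨h1, h2⟩ => by omega

/-- Since `|w j| < (1 - |w i| ^ (2 p i)) ^ b`, it suffices that `t (1 - t ^ (2 p i)) ^ b exp (m t)`
is largest at `t = |z i|`; the slope `m` is chosen for this. -/
lemma exists_isMobiusCompetitor_of_exp {p : Fin 2 → ℝ} (hp : ∀ j, 0 < p j) {i j : Fin 2}
    (hij : i ≠ j) {z : EuclideanSpace ℂ (Fin 2)} (hz : z ∈ ellipsoid p) (hzi : z i ≠ 0)
    (hzx : p j * (1 - ‖z i‖ ^ (2 * p i)) ≤ p i * ‖z i‖ ^ (2 * p i))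
    (h : (1 - 2 * p i) ^ 2 < 8 * p j) :
    ∃ f, IsMobiusCompetitor (ellipsoid p) (hyperplanes (ellipsoid p) 2) f ∧
      ‖f z‖ = ‖z j‖ / (1 - ‖z i‖ ^ (2 * p i)) ^ (2 * p j)⁻¹ := by
  have hpi := hp i
  have hpj := hp j
  set b := (2 * p j)⁻¹ with hb
  have hbpos : 0 < b := by positivity
  have hz01 : ‖z i‖ ∈ Set.Ioo (0 : ℝ) 1 :=
    ⟨norm_pos_iff.2 hzi, norm_lt_one_of_mem_ellipsoid hp hz i⟩
  obtain ⟨hx0, hx1⟩ := rpow_two_mul_mem_Ioo hpi hz01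
  set x := ‖z i‖ ^ (2 * p i) with hx
  have h' : (1 - 2 * p i) ^ 2 * b < 4 := by
    rw [hb, ← div_eq_mul_inv, div_lt_iff₀ (by positivity)]
    linarith
  set m := logSlope (p i) b ‖z i‖ with hm
  have h1x : 0 < 1 - x := by linarith
  -- This is what `hzx` is for: with `m ≥ 0`, replacing the real part in the exponent by `‖w i‖`
  -- only increases the exponential.
  have hm0 : 0 ≤ m := by
    refine div_nonneg ?_ (norm_nonneg _)
    rw [← hx, hb, sub_nonneg, ← mul_div_assoc, le_div_iff₀ h1x, ← div_eq_mul_inv,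
      div_mul_eq_mul_div, le_div_iff₀ (by positivity)]
    linarith
  have hexp : ∀ t ∈ Set.Ioo (0 : ℝ) 1, t * (1 - t ^ (2 * p i)) ^ b * Real.exp (m * t)
      = Real.exp (Real.log t + b * Real.log (1 - t ^ (2 * p i)) + m * t) := by
    intro t ht
    have := rpow_two_mul_mem_Ioo hpi ht
    rw [Real.exp_add, Real.exp_add, Real.exp_log ht.1, mul_comm b,
      ← Real.rpow_def_of_pos (by linarith [this.2])]
  set D : ℝ := ‖z i‖ * (1 - x) ^ b * Real.exp (m * ‖z i‖) with hD
  have hDpos : 0 < D := mul_pos (mul_pos hz01.1 (Real.rpow_pos_of_pos h1x _)) (Real.exp_pos _)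
  set f : EuclideanSpace ℂ (Fin 2) → ℂ := fun w =>
    w i * w j * Complex.exp (m * (w i * ((starRingEnd ℂ) (z i) / (‖z i‖ : ℂ)))) / (D : ℂ) with hf
  have hfn : ∀ w, ‖f w‖ = ‖w i‖ * ‖w j‖ *
      Real.exp (m * (w i * ((starRingEnd ℂ) (z i) / (‖z i‖ : ℂ))).re) / D := by
    intro w
    simp only [hf]
    rw [norm_div, norm_mul, norm_mul, Complex.norm_exp, Complex.norm_real,
      Real.norm_of_nonneg hDpos.le, Complex.re_ofReal_mul]
  have hunit : ‖(starRingEnd ℂ) (z i) / (‖z i‖ : ℂ)‖ = 1 := by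
    rw [norm_div, RCLike.norm_conj, Complex.norm_real, norm_norm, div_self hz01.1.ne']
  refine ⟨f, ⟨?_, fun w hw => ?_, fun a ha => ?_⟩, ?_⟩
  · refine Differentiable.differentiableOn ?_
    fun_prop
  · rw [hfn, div_lt_one hDpos]
    rcases eq_or_ne (w i) 0 with h0 | h0
    · rw [h0]
      simpa using hDpos
    have ht : ‖w i‖ ∈ Set.Ioo (0 : ℝ) 1 :=
      ⟨norm_pos_iff.2 h0, norm_lt_one_of_mem_ellipsoid hp hw i⟩
    have hy := rpow_two_mul_mem_Ioo hpi ht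
    have hwj : ‖w j‖ < (1 - ‖w i‖ ^ (2 * p i)) ^ b := by
      have h2 := mem_ellipsoid.1 hw
      rw [sum_fin_two_of_ne hij] at h2
      have h3 : ‖w j‖ ^ (2 * p j) < 1 - ‖w i‖ ^ (2 * p i) := by linarith
      have h4 := Real.rpow_lt_rpow (Real.rpow_nonneg (norm_nonneg _) _) h3 hbpos
      rwa [rpow_two_mul_rpow_inv hp (norm_nonneg _)] at h4
    have hre : (w i * ((starRingEnd ℂ) (z i) / (‖z i‖ : ℂ))).re ≤ ‖w i‖ := by
      refine (Complex.re_le_norm _).trans ?_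
      rw [norm_mul, hunit, mul_one]
    calc ‖w i‖ * ‖w j‖ * Real.exp (m * (w i * ((starRingEnd ℂ) (z i) / (‖z i‖ : ℂ))).re)
        ≤ ‖w i‖ * ‖w j‖ * Real.exp (m * ‖w i‖) := by gcongr
      _ < ‖w i‖ * (1 - ‖w i‖ ^ (2 * p i)) ^ b * Real.exp (m * ‖w i‖) := by
          have := ht.1
          gcongr
      _ ≤ D := by
          rw [hexp _ ht, hD, hx, hexp _ hz01]
          exact Real.exp_le_exp.2 (log_add_log_one_sub_le hpi hbpos h' hz01 ht)
  · obtain ⟨-, l, -, hl⟩ := mem_hyperplanes.1 ha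
    have : l = i ∨ l = j := by omega
    rcases this with rfl | rfl <;> simp [hf, hl]
  · have h2 : z i * ((starRingEnd ℂ) (z i) / (‖z i‖ : ℂ)) = (‖z i‖ : ℂ) := by
      rw [← mul_div_assoc, Complex.mul_conj, Complex.normSq_eq_norm_sq]
      have : (‖z i‖ : ℂ) ≠ 0 := by simpa using hzi
      push_cast
      field_simp
    rw [hfn, h2, Complex.ofReal_re, hD]
    have := hz01.1
    field_simp

/-- At most one coordinate can have its level equal to `|z i| ^ (2 p i)`, as these powers sum to
less than `1`. If that one is not convex, the other has level `c / (2 p j) = 1 - |z i| ^ (2 p i)`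
and the exponential competitor applies. -/
lemma exists_isMobiusCompetitor_of_two {p : Fin 2 → ℝ} (hp : ∀ j, 0 < p j) {c : ℝ} (hc : 0 < c)
    {z : EuclideanSpace ℂ (Fin 2)} (hz : z ∈ ellipsoid p) (hX : ∑ j, level p 2 c z j = 1)
    (hne : ∀ j, z j ≠ 0)
    (h : ∀ i j : Fin 2, i ≠ j → 1 / 2 ≤ p i ∨ (1 - 2 * p i) ^ 2 < 8 * p j) :
    ∃ f, IsMobiusCompetitor (ellipsoid p) (hyperplanes (ellipsoid p) 2) f ∧
      ‖f z‖ = levelProd p 2 c z := by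
  by_cases hall : ∀ i : Fin 2, level p 2 c z i = c / (2 * p i) ∨ 1 / 2 ≤ p i
  · exact exists_isMobiusCompetitor_of_convex hp hc hX ⟨0, by simp⟩ fun j hj _ =>
      (hall j).resolve_left fun h => hj ⟨by omega, h⟩
  push Not at hall
  obtain ⟨i, hi1, hi2⟩ := hall
  obtain ⟨j, hij⟩ : ∃ j : Fin 2, i ≠ j := ⟨1 - i, by omega⟩
  have hpi := hp i
  have hpj := hp j
  have hXi : level p 2 c z i = ‖z i‖ ^ (2 * p i) :=
    (level_eq_or z i).resolve_right fun h => hi1 h.2.2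
  have hX2 := hX
  rw [sum_fin_two_of_ne hij] at hX2
  have hXj : level p 2 c z j = c / (2 * p j) := by
    rcases level_eq_or (p := p) (k := 2) (c := c) z j with h | h
    · have h2 := mem_ellipsoid.1 hz
      rw [sum_fin_two_of_ne hij] at h2
      linarith
    · exact h.2.2
  have hXj' : 1 - ‖z i‖ ^ (2 * p i) = level p 2 c z j := by linarith
  have hle : c / (2 * p i) ≤ ‖z i‖ ^ (2 * p i) := by
    rw [← hXi, level_of_lt (by omega)]
    exact le_max_left _ _
  obtain ⟨f, hf1, hf2⟩ := exists_isMobiusCompetitor_of_exp hp hij hz (hne i) (by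
    rw [hXj', hXj]
    rw [div_le_iff₀ (by positivity)] at hle
    have : p j * (c / (2 * p j)) = c / 2 := by field_simp
    linarith) ((h i j hij).resolve_left (not_le.2 hi2))
  refine ⟨f, hf1, hf2.trans ?_⟩
  have huniv : Finset.univ.filter (fun j : Fin 2 => (j : ℕ) < 2) = {i, j} := by
    ext l
    simp only [Finset.mem_filter, Finset.mem_univ, true_and, Finset.mem_insert,
      Finset.mem_singleton]
    omega
  rw [levelProd, huniv, Finset.prod_pair hij, ← hXj', hXi,
    rpow_two_mul_rpow_inv hp (norm_nonneg _), div_self (norm_ne_zero_iff.2 (hne i)), one_mul]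

/-! ### A non-convex free coordinate -/

/-- The point with small fixed coordinates of index less than `k`, coordinate `t` at `j₀`, and
further coordinates zero. -/
def testPoint (p : Fin n → ℝ) (k : ℕ) (j₀ : Fin n) (t : ℂ) : EuclideanSpace ℂ (Fin n) :=
  WithLp.toLp 2 (fun l : Fin n => if (l : ℕ) < k then
    (((8 * p l * qSum p k)⁻¹ ^ (2 * p l)⁻¹ : ℝ) : ℂ) else 0) + t • EuclideanSpace.single j₀ (1 : ℂ)

lemma qSum_pos (hp : ∀ j, 0 < p j) (hk : 1 ≤ k) (hkn : k ≤ n) : 0 < qSum p k :=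
  Finset.sum_pos (fun j _ => inv_pos.2 (by have := hp j; positivity))
    ⟨⟨0, by omega⟩, by simp; omega⟩

lemma norm_testPoint_rpow (hp : ∀ j, 0 < p j) (hk : 1 ≤ k) (hkn : k ≤ n) {j₀ : Fin n}
    (hj₀ : k ≤ (j₀ : ℕ)) (t : ℂ) (l : Fin n) :
    ‖testPoint p k j₀ t l‖ ^ (2 * p l) = if (l : ℕ) < k then (8 * p l * qSum p k)⁻¹
      else if l = j₀ then ‖t‖ ^ (2 * p j₀) else 0 := by
  have hq := qSum_pos hp hk hkn
  have hpl := hp l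
  split_ifs with h1 h2
  · have h3 : l ≠ j₀ := by rintro rfl; omega
    have h4 : testPoint p k j₀ t l = (((8 * p l * qSum p k)⁻¹ ^ (2 * p l)⁻¹ : ℝ) : ℂ) := by
      simp [testPoint, h1, h3]
    rw [h4, Complex.norm_real, Real.norm_of_nonneg (by positivity),
      rpow_inv_rpow_two_mul hp (by positivity)]
  · subst h2
    simp [testPoint, h1]
  · have h4 : testPoint p k j₀ t l = 0 := by simp [testPoint, h1, h2]
    rw [h4, norm_zero, Real.zero_rpow (by positivity)]

lemma sum_ite_lt_add_single {j₀ : Fin n} (hj₀ : k ≤ (j₀ : ℕ)) (a : Fin n → ℝ) (T : ℝ) :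
    ∑ l : Fin n, (if (l : ℕ) < k then a l else if l = j₀ then T else 0)
      = ∑ l ∈ Finset.univ.filter (fun l : Fin n => (l : ℕ) < k), a l + T := by
  have : ∀ l : Fin n, (if (l : ℕ) < k then a l else if l = j₀ then T else 0)
      = (if (l : ℕ) < k then a l else 0) + if l = j₀ then T else 0 := by
    intro l
    by_cases h1 : (l : ℕ) < k
    · rw [if_pos h1, if_pos h1, if_neg (by rintro rfl; omega), add_zero]
    · rw [if_neg h1, if_neg h1, zero_add]
  simp only [this, Finset.sum_add_distrib, Finset.sum_filter]
  simp

/-- The constant `8` in `testPoint` makes the first `k` terms sum to `1 / 4`. So for `|t| ^ (2 p j₀)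
≤ 1 / 2` the point stays in the ellipsoid and each of these coordinates has level `c / (2 p l)`. -/
lemma testPoint_spec (hp : ∀ j, 0 < p j) (hk : 1 ≤ k) (hkn : k ≤ n) {j₀ : Fin n}
    (hj₀ : k ≤ (j₀ : ℕ)) {t : ℂ} (ht : ‖t‖ ^ (2 * p j₀) ≤ 1 / 2) :
    testPoint p k j₀ t ∈ ellipsoid p ∧
    ∃ c, 0 < c ∧ ∑ j, level p k c (testPoint p k j₀ t) j = 1 ∧
      levelProd p k c (testPoint p k j₀ t)
        = (4 * (1 - ‖t‖ ^ (2 * p j₀)))⁻¹ ^ qSum p k := by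
  have hq := qSum_pos hp hk hkn
  set q := qSum p k with hqdef
  set T := ‖t‖ ^ (2 * p j₀) with hT
  have hT0 : 0 ≤ T := Real.rpow_nonneg (norm_nonneg _) _
  have hx := norm_testPoint_rpow hp hk hkn hj₀ t
  have hmul : ∀ s : ℝ, ∑ l ∈ Finset.univ.filter (fun l : Fin n => (l : ℕ) < k), s / (2 * p l)
      = s * q := by
    intro s
    rw [hqdef, qSum, Finset.mul_sum]
    rfl
  have h1T : 0 < 1 - T := by linarith
  refine ⟨?_, (1 - T) / q, by positivity, ?_, ?_⟩
  · rw [mem_ellipsoid]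
    simp only [hx]
    rw [sum_ite_lt_add_single hj₀]
    have : ∀ l, (8 * p l * q)⁻¹ = (4 * q)⁻¹ / (2 * p l) := by
      intro l
      have := hp l
      field_simp
      norm_num
    simp only [← hqdef, this, hmul]
    have : (4 * q)⁻¹ * q = 1 / 4 := by field_simp
    linarith
  all_goals
    have hlevel : ∀ l, level p k ((1 - T) / q) (testPoint p k j₀ t) l =
        if (l : ℕ) < k then (1 - T) / q / (2 * p l) else if l = j₀ then T else 0 := by
      intro l
      have hpl := hp l
      rw [level, hx]
      split_ifs with h1 h2
      · rw [max_eq_left]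
        rw [← hqdef, inv_eq_one_div, div_div, div_le_div_iff₀ (by positivity) (by positivity)]
        have : 0 < q * p l := by positivity
        nlinarith
      · rfl
      · rfl
  · simp only [hlevel]
    rw [sum_ite_lt_add_single hj₀, hmul, div_mul_cancel₀ _ hq.ne']
    ring
  · have h2 : ∀ l ∈ Finset.univ.filter (fun l : Fin n => (l : ℕ) < k),
        ‖testPoint p k j₀ t l‖ / level p k ((1 - T) / q) (testPoint p k j₀ t) l ^ (2 * p l)⁻¹
        = (4 * (1 - T))⁻¹ ^ (2 * p l)⁻¹ := by
      intro l hl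
      have hpl := hp l
      have hlk : (l : ℕ) < k := by simpa using hl
      rw [hlevel, if_pos hlk, ← rpow_two_mul_rpow_inv hp (norm_nonneg (testPoint p k j₀ t l)) l, hx,
        if_pos hlk, ← Real.div_rpow (by positivity) (by positivity)]
      congr 1
      rw [← hqdef]
      field_simp
      norm_num
    rw [levelProd, Finset.prod_congr rfl h2, hqdef, qSum, Real.rpow_sum_of_pos (by positivity)]

lemma one_add_mul_le_one_sub_rpow_neg {q T : ℝ} (hq : 0 ≤ q) (hT : T < 1) :
    1 + q * T ≤ (1 - T)⁻¹ ^ q := by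
  have h1 : 0 < 1 - T := by linarith
  rw [Real.rpow_def_of_pos (inv_pos.2 h1), Real.log_inv]
  have h2 := Real.log_le_sub_one_of_pos h1
  have h3 := Real.add_one_le_exp (-Real.log (1 - T) * q)
  nlinarith

lemma exists_mobius_ne_green (hp : ∀ j, 0 < p j) (hk : 1 ≤ k) (hkn : k ≤ n) {j₀ : Fin n}
    (hj₀ : k ≤ (j₀ : ℕ)) (hpj : p j₀ < 1 / 2) :
    ∃ z ∈ ellipsoid p, mobius (ellipsoid p) (hyperplanes (ellipsoid p) k) z
      ≠ green (ellipsoid p) (hyperplanes (ellipsoid p) k) z := by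
  have hq := qSum_pos hp hk hkn
  set q := qSum p k with hqdef
  have hpos := hp j₀
  set r : ℝ := (1 / 2) ^ (2 * p j₀)⁻¹ with hr
  have hr0 : 0 < r := by positivity
  have hrle : ∀ t : ℂ, ‖t‖ < r → ‖t‖ ^ (2 * p j₀) ≤ 1 / 2 := by
    intro t ht
    have := Real.rpow_le_rpow (norm_nonneg _) ht.le (z := 2 * p j₀) (by positivity)
    rwa [hr, rpow_inv_rpow_two_mul hp (by norm_num)] at this
  -- Chosen so that `(2 / r) B = (1 / 4) ^ q * q`; as `2 p j₀ < 1`, a small `t` satisfies `t < B t ^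
  -- (2 p j₀)`.
  set B : ℝ := (1 / 4) ^ q * q * r / 2 with hB
  have hB0 : 0 < B := by positivity
  have hexp : 0 < 1 - 2 * p j₀ := by linarith
  obtain ⟨t, ht0, ht⟩ : ∃ t : ℝ, 0 < t ∧ t < min r (B ^ (1 - 2 * p j₀)⁻¹) :=
    exists_between (lt_min hr0 (Real.rpow_pos_of_pos hB0 _))
  have htr := ht.trans_le (min_le_left _ _)
  have htB : t < B * t ^ (2 * p j₀) := by
    have h1 := Real.rpow_lt_rpow ht0.le (ht.trans_le (min_le_right _ _)) hexp
    rw [Real.rpow_inv_rpow hB0.le hexp.ne'] at h1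
    have h2 : t = t ^ (1 - 2 * p j₀) * t ^ (2 * p j₀) := by
      rw [← Real.rpow_add ht0, sub_add_cancel, Real.rpow_one]
    calc t = t ^ (1 - 2 * p j₀) * t ^ (2 * p j₀) := h2
      _ < B * t ^ (2 * p j₀) := mul_lt_mul_of_pos_right h1 (Real.rpow_pos_of_pos ht0 _)
  have hnt : ‖(t : ℂ)‖ = t := by rw [Complex.norm_real, Real.norm_of_nonneg ht0.le]
  have htle := hrle t (by rwa [hnt])
  obtain ⟨hzE, c, hc, hX, hval⟩ := testPoint_spec hp hk hkn hj₀ htle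
  refine ⟨testPoint p k j₀ t, hzE, ne_of_lt ?_⟩
  rw [green_eq_levelProd hp hzE hc hX, hval, hnt]
  rw [hnt] at htle
  set T := t ^ (2 * p j₀) with hT
  have hle : mobius (ellipsoid p) (hyperplanes (ellipsoid p) k) (testPoint p k j₀ t)
      ≤ (1 / 4) ^ q + 2 / r * t := by
    refine csSup_le ⟨_, fun _ => 0, ⟨differentiableOn_const _, by simp, fun _ _ => rfl⟩, rfl⟩ ?_
    rintro _ ⟨f, hf, rfl⟩
    have h0 : ‖f (testPoint p k j₀ 0)‖ ≤ (1 / 4) ^ q := by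
      obtain ⟨hE0, c', hc', hX', hval'⟩ := testPoint_spec (t := 0) hp hk hkn hj₀ (by
        rw [norm_zero, Real.zero_rpow (by positivity)]; norm_num)
      refine (hf.norm_le_levelProd hp hE0 hc' hX').trans_eq ?_
      rw [hval', norm_zero, Real.zero_rpow (by positivity), ← hqdef]
      norm_num
    have hmem : ∀ s : ℂ, ‖s‖ < r → testPoint p k j₀ s ∈ ellipsoid p := fun s hs =>
      (testPoint_spec hp hk hkn hj₀ (hrle s hs)).1
    have hd : DifferentiableOn ℂ (fun s : ℂ => f (testPoint p k j₀ s)) (Metric.ball 0 r) := by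
      refine hf.holo.comp ?_ fun s hs => hmem s (by simpa using hs)
      unfold testPoint
      fun_prop
    -- Two values of `f` in the unit disc are less than `2` apart.
    have h1 := Complex.dist_le_div_mul_dist_of_mapsTo_ball (R₂ := 2) hd (fun s hs => by
      rw [mem_closedBall_iff_norm]
      have h2 := hf.mapsTo _ (hmem s (by simpa using hs))
      have h3 := hf.mapsTo _ (hmem 0 (by simpa using hr0))
      linarith [norm_sub_le (f (testPoint p k j₀ s)) (f (testPoint p k j₀ 0))]) (z := (t : ℂ))
      (by simpa [abs_of_pos ht0] using htr)
    rw [dist_zero_right, hnt, dist_eq_norm] at h1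
    have h2 := norm_le_norm_add_norm_sub' (f (testPoint p k j₀ t)) (f (testPoint p k j₀ 0))
    linarith
  refine hle.trans_lt ?_
  have h3 := one_add_mul_le_one_sub_rpow_neg hq.le (T := T) (by linarith)
  have h4 : (4 * (1 - T))⁻¹ ^ q = (1 / 4) ^ q * (1 - T)⁻¹ ^ q := by
    rw [← Real.mul_rpow (by norm_num) (inv_nonneg.2 (by linarith)), mul_inv, one_div]
  have h5 : 2 / r * t < (1 / 4) ^ q * (q * T) := by
    calc 2 / r * t < 2 / r * (B * T) := mul_lt_mul_of_pos_left htB (by positivity)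
      _ = (1 / 4) ^ q * (q * T) := by
        rw [hB]
        field_simp
  calc (1 / 4) ^ q + 2 / r * t < (1 / 4) ^ q * (1 + q * T) := by linarith
    _ ≤ (4 * (1 - T))⁻¹ ^ q := by
      rw [h4]
      gcongr

/-! ### The cases in which the two functions agree -/

lemma mobius_of_half_le (hp : ∀ j, 0 < p j) (hk : 1 ≤ k) (hkn : k ≤ n)
    (h : ∀ j, 1 / 2 ≤ p j) :
    Set.EqOn (mobius (ellipsoid p) (hyperplanes (ellipsoid p) k))
      (green (ellipsoid p) (hyperplanes (ellipsoid p) k)) (ellipsoid p) ∧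
    EqualsR p k (mobius (ellipsoid p) (hyperplanes (ellipsoid p) k)) :=
  mobius_eqOn_green_and_equalsR hp hk hkn fun _ _ _ hc hX _ =>
    exists_isMobiusCompetitor_of_convex hp hc hX ⟨⟨0, by omega⟩, hk⟩ fun j _ _ => h j

lemma mobius_of_one_two {p : Fin 2 → ℝ} (hp : ∀ j, 0 < p j) (h : 1 / 2 ≤ p 1) :
    Set.EqOn (mobius (ellipsoid p) (hyperplanes (ellipsoid p) 1))
      (green (ellipsoid p) (hyperplanes (ellipsoid p) 1)) (ellipsoid p) ∧
    EqualsR p 1 (mobius (ellipsoid p) (hyperplanes (ellipsoid p) 1)) := by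
  refine mobius_eqOn_green_and_equalsR hp le_rfl one_le_two fun z hz c hc hX _ =>
    exists_isMobiusCompetitor_of_convex hp hc hX ⟨0, by simp⟩ fun j hj _ => ?_
  obtain rfl | rfl : j = 0 ∨ j = 1 := by omega
  · exfalso
    refine hj ⟨by simp, ?_⟩
    -- If the level of the first coordinate were `|z 0| ^ (2 p 0)`, the levels would sum to less
    -- than `1`. So only the second coordinate needs convexity.
    rcases level_eq_or (p := p) (k := 1) (c := c) z 0 with h0 | h0
    · have h1 := mem_ellipsoid.1 hz
      rw [Fin.sum_univ_two] at h1 hX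
      rw [level_of_not_lt (j := 1) (by simp)] at hX
      linarith
    · exact h0.2.2
  · exact h

lemma mobius_of_two_two {p : Fin 2 → ℝ} (hp : ∀ j, 0 < p j) (h12 : p 0 ≤ p 1)
    (h : 1 / 2 ≤ p 1 ∨ 1 < 8 * p 0 + 4 * p 1 * (1 - p 1)) :
    Set.EqOn (mobius (ellipsoid p) (hyperplanes (ellipsoid p) 2))
      (green (ellipsoid p) (hyperplanes (ellipsoid p) 2)) (ellipsoid p) ∧
    EqualsR p 2 (mobius (ellipsoid p) (hyperplanes (ellipsoid p) 2)) := by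
  refine mobius_eqOn_green_and_equalsR hp one_le_two le_rfl fun z hz c hc hX hne =>
    exists_isMobiusCompetitor_of_two hp hc hz hX (fun j => hne j (by omega)) fun i j hij => ?_
  have hp0 := hp 0
  rcases le_or_gt (1 / 2) (p i) with hi | hi
  · exact Or.inl hi
  · right
    have hpi := hp i
    -- The second alternative in `h` is `(1 - 2 p 1) ^ 2 < 8 p 0`; the inequality with the indices
    -- exchanged follows from it by `p 0 ≤ p 1`.
    obtain ⟨rfl, rfl⟩ | ⟨rfl, rfl⟩ : (i = 0 ∧ j = 1) ∨ (i = 1 ∧ j = 0) := by omega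
    · rcases h with h | h <;> nlinarith
    · rcases h with h | h <;> nlinarith

end MobiusGreen

end

theorem theorem1 (n : ℕ) (hn : 2 ≤ n) (k : ℕ) (hk : 1 ≤ k) (hkn : k ≤ n)
    (p : Fin n → ℝ) (hp : ∀ j, 0 < p j)
    (E A : Set (EuclideanSpace ℂ (Fin n)))
    (hE : E = MobiusGreen.ellipsoid p) (hA : A = MobiusGreen.hyperplanes E k) :
    -- (a)
    MobiusGreen.EqualsR p k (MobiusGreen.green E A) ∧
    -- (b)
    ((∀ j, 1 / 2 ≤ p j) →
      Set.EqOn (MobiusGreen.mobius E A) (MobiusGreen.green E A) E ∧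
      MobiusGreen.EqualsR p k (MobiusGreen.mobius E A)) ∧
    -- (c)
    (k = 1 → n = 2 → 1 / 2 ≤ p ⟨1, by omega⟩ →
      Set.EqOn (MobiusGreen.mobius E A) (MobiusGreen.green E A) E ∧
      MobiusGreen.EqualsR p k (MobiusGreen.mobius E A)) ∧
    -- (d)
    ((∃ j : Fin n, k ≤ (j : ℕ) ∧ p j < 1 / 2) →
      ∃ z ∈ E, MobiusGreen.mobius E A z ≠ MobiusGreen.green E A z) ∧
    -- (e)
    (k = 2 → n = 2 → p ⟨0, by omega⟩ ≤ p ⟨1, by omega⟩ →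
      (1 / 2 ≤ p ⟨1, by omega⟩ ∨
        1 < 8 * p ⟨0, by omega⟩ + 4 * p ⟨1, by omega⟩ * (1 - p ⟨1, by omega⟩)) →
      Set.EqOn (MobiusGreen.mobius E A) (MobiusGreen.green E A) E ∧
      MobiusGreen.EqualsR p k (MobiusGreen.mobius E A)) := by
  subst hE
  subst hA
  refine ⟨MobiusGreen.green_equalsR hp hk hkn, MobiusGreen.mobius_of_half_le hp hk hkn,
    fun hk1 hn2 h => ?_, ?_, fun hk2 hn2 h12 h => ?_⟩
  · subst hk1
    subst hn2
    exact MobiusGreen.mobius_of_one_two hp h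
  · rintro ⟨j, hj, hpj⟩
    exact MobiusGreen.exists_mobius_ne_green hp hk hkn hj hpj
  · subst hk2
    subst hn2
    exact MobiusGreen.mobius_of_two_two hp h12 h
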